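/- Let $\alpha_0,\alpha_1,\alpha_2>-1$ with $\alpha_1-\alpha_2\notin\mathbb Z$, and consider the Jacobi--Piñeiro system on $[0,1]$: the weights $w_1(x)=x^{\alpha_1}$, $w_2(x)=x^{\alpha_2}$ with respect to $\mathrm d\mu(x)=(1-x)^{\alpha_0}\,\mathrm dx$. Put $\chi=(1,x,x^2,\dots)^\top$ and $\xi=(w_1,w_2,xw_1,xw_2,x^2w_1,x^2w_2,\dots)^\top$. The moment matrix $g=\int_0^1\chi\,\xi^\top\,\mathrm d\mu$ has a unique Gauss--Borel factorization $g=S^{-1}D\,\tilde S^{-\top}$ with $S,\tilde S$ semi-infinite lower unitriangular matrices and $D$ an invertible diagonal matrix. Let $(B_0,B_1,\dots)^\top=S\chi$ be the type II multiple orthogonal polynomials, $(Q_0,Q_1,\dots)^\top=D^{-1}\tilde S\xi$ the type I linear forms, and $H=S\Lambda S^{-1}$ the associated tetradiagonal Hessenberg matrix, where $\Lambda_{i,j}=\delta_{i+1,j}$. Then $B_n(1)\ne0$ and $Q_n(1)\neq 0$ for all $n\ge0$, so that the dual matrices of type II and type I, $$\hat H=\sigma_{II}^{-1}H\,\sigma_{II},\quad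 \sigma_{II}=\operatorname{diag}(B_0(1),B_1(1),\dots),\qquad \check H=\sigma_I^{-1}H^\top\sigma_I,\quad \sigma_I=\operatorname{diag}(Q_0(1),Q_1(1),\dots),$$ called the Jacobi--Piñeiro stochastic matrices of type II and I, are well defined. Their large-$n$ limits are the same after transposition: for every $k\in\{-2,-1,0,1,2\}$ the limits below exist, are finite, and $$\lim_{n\to\infty}\check H_{n,n+k}=\lim_{n\to\infty}\hat H_{n+k,n}.$$ -/

import Mathlib

open Filter Topology

namespace JacobiPineiro

noncomputable section

/-! ### Semi-infinite matrices, indexed from zero -/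

/-- Lower unitriangular semi-infinite matrices. -/
def IsLowerUnitriangular (S : Matrix ℕ ℕ ℝ) : Prop :=
  (∀ i, S i i = 1) ∧ ∀ i j, i < j → S i j = 0

/-- The inverse of a lower unitriangular semi-infinite matrix. Row `i` is the last row of the
inverse of the leading block with rows and columns `0, …, i`. -/
def lowerInv (S : Matrix ℕ ℕ ℝ) : Matrix ℕ ℕ ℝ := fun i j =>
  if h : j < i + 1 then
    (Matrix.of fun a b : Fin (i + 1) => S a b)⁻¹ (Fin.last i) ⟨j, h⟩
  else 0

/-- `lowerInv S` is indeed inverse to `S`. -/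
theorem lowerInv_mul {S : Matrix ℕ ℕ ℝ} (hS : IsLowerUnitriangular S) (i k : ℕ) :
    ∑ j ∈ Finset.range (i + 1), lowerInv S i j * S j k = if i = k then 1 else 0 := by
  by_cases hk : k < i + 1
  · set M : Matrix (Fin (i + 1)) (Fin (i + 1)) ℝ := Matrix.of fun a b => S a b with hM
    have hdet : M.det = 1 := by
      rw [Matrix.det_of_isLowerTriangular]
      · simp [hM, hS.1]
      · intro a b hab
        exact hS.2 _ _ hab
    have h1 : M⁻¹ * M = 1 := Matrix.nonsing_inv_mul M (by simp [hdet])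
    have h2 := congrFun (congrFun h1 (Fin.last i)) ⟨k, hk⟩
    rw [Matrix.mul_apply, Matrix.one_apply] at h2
    rw [Finset.sum_range]
    have h3 : ∀ j : Fin (i + 1), lowerInv S i j * S j k
        = M⁻¹ (Fin.last i) j * M j ⟨k, hk⟩ := by
      intro j
      rw [lowerInv, dif_pos j.isLt]
      rfl
    simp only [h3, h2, Fin.ext_iff, Fin.val_last]
  · have hne : i ≠ k := by omega
    rw [if_neg hne]
    refine Finset.sum_eq_zero fun j hj => ?_
    rw [hS.2 j k (by have := Finset.mem_range.1 hj; omega), mul_zero]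

/-- The data of a factorization `g = S⁻¹ H S̃⁻ᵀ`: the matrix `S`, the diagonal entries
`H₀, H₁, …` of `H`, and the matrix `S̃`. -/
@[ext]
structure Factors where
  S : Matrix ℕ ℕ ℝ
  H : ℕ → ℝ
  St : Matrix ℕ ℕ ℝ

instance : Nonempty Factors := ⟨⟨0, 0, 0⟩⟩

/-- `F` is a Gauss–Borel factorization of `g`: `S` and `S̃` are lower unitriangular, `H` is an
invertible diagonal matrix, and `g = S⁻¹ H S̃⁻ᵀ` (the entries of the product are finite sums). -/
def IsGaussBorel (g : Matrix ℕ ℕ ℝ) (F : Factors) : Prop :=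
  IsLowerUnitriangular F.S ∧ IsLowerUnitriangular F.St ∧ (∀ n, F.H n ≠ 0) ∧
    ∀ i j, g i j =
      ∑ l ∈ Finset.range (i + 1), lowerInv F.S i l * F.H l * lowerInv F.St j l

/-- The Gauss–Borel factorization of `g` (an arbitrary value if there is none). -/
def gaussBorel (g : Matrix ℕ ℕ ℝ) : Factors := Classical.epsilon (IsGaussBorel g)

/-! ### The Jacobi–Piñeiro system

The weights are `w₁ x = x ^ α₁` and `w₂ x = x ^ α₂` on `[0, 1]`, with respect to the measure
`dμ = (1 - x) ^ α₀ dx`. -/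

/-- The undressed linear forms `w₁, w₂, x w₁, x w₂, x² w₁, x² w₂, …`. -/
def xi (α₁ α₂ : ℝ) (j : ℕ) (x : ℝ) : ℝ :=
  x ^ (j / 2) * if Even j then x ^ α₁ else x ^ α₂

/-- The moment matrix `g = ∫ χ ξᵀ dμ`, where `χ = (1, x, x², …)ᵀ`. -/
def moment (α₀ α₁ α₂ : ℝ) : Matrix ℕ ℕ ℝ := fun i j =>
  ∫ x in (0 : ℝ)..1, x ^ i * xi α₁ α₂ j x * (1 - x) ^ α₀

/-- The factors `S`, `H`, `S̃` of the moment matrix. -/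
def factors (α₀ α₁ α₂ : ℝ) : Factors := gaussBorel (moment α₀ α₁ α₂)

/-- The type II multiple orthogonal polynomials, `(B₀, B₁, …)ᵀ = S χ`. -/
def B (α₀ α₁ α₂ : ℝ) (n : ℕ) (x : ℝ) : ℝ :=
  ∑ i ∈ Finset.range (n + 1), (factors α₀ α₁ α₂).S n i * x ^ i

/-- The type I linear forms, `(Q₀, Q₁, …)ᵀ = H⁻¹ S̃ ξ`. -/
def Q (α₀ α₁ α₂ : ℝ) (n : ℕ) (x : ℝ) : ℝ :=
  ((factors α₀ α₁ α₂).H n)⁻¹ *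
    ∑ j ∈ Finset.range (n + 1), (factors α₀ α₁ α₂).St n j * xi α₁ α₂ j x

/-- The Hessenberg matrix `S Λ S⁻¹`, where `Λ` is the shift matrix, whose entries are `1` at the
places `(i, i + 1)` and `0` elsewhere. -/
def hess (α₀ α₁ α₂ : ℝ) : Matrix ℕ ℕ ℝ := fun n m =>
  ∑ i ∈ Finset.range (n + 1),
    (factors α₀ α₁ α₂).S n i * lowerInv (factors α₀ α₁ α₂).S (i + 1) m

/-- The type II stochastic matrix `Ĥ = σ⁻¹ (S Λ S⁻¹) σ`, `σ = diag(B₀(1), B₁(1), …)`. -/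
def hatH (α₀ α₁ α₂ : ℝ) : Matrix ℕ ℕ ℝ := fun n m =>
  (B α₀ α₁ α₂ n 1)⁻¹ * hess α₀ α₁ α₂ n m * B α₀ α₁ α₂ m 1

/-- The type I stochastic matrix `Ȟ = σ⁻¹ (S Λ S⁻¹)ᵀ σ`, `σ = diag(Q₀(1), Q₁(1), …)`. -/
def checkH (α₀ α₁ α₂ : ℝ) : Matrix ℕ ℕ ℝ := fun n m =>
  (Q α₀ α₁ α₂ n 1)⁻¹ * hess α₀ α₁ α₂ m n * Q α₀ α₁ α₂ m 1

end

end JacobiPineiro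

namespace JacobiPineiro

open Finset Polynomial

/-! ### Linear algebra of semi-infinite lower unitriangular matrices -/

/-! Put `β = α₀ + 1` and let `t j` (`node`) be the exponent of `ξ_j`. Every moment is a Beta value,
so pairing a polynomial of degree `n` with `ξ_j` gives a nonzero Gamma factor times the value at `t
j` of a polynomial of degree at most `n` (`sum_mul_moment`). Orthogonality prescribes the zeros of
that polynomial, hence `mellin_factors`: for `B_n` it is a multiple of `∏_{j<n} (X - t j)`. Its
value at `-(β + n)`, its leading coefficient and its value at `-1` encode the leading coefficient of
`B_n`, `B_n(1)` and `B_n(0)`. These are therefore explicit products, with ratios of consecutive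
terms tending to `8/27` for `B_n(1)` and `-4/27` for `B_n(0)`.

The Hessenberg matrix is banded because `g (i+1) j = g i (j+2)`. Its lowest diagonal is `H (n+2) / H
n`, which converges; the recurrence at `x = 1` and at `x = 0` is a linear system for the two other
unknown diagonals, solvable in the limit because `8/27 ≠ -4/27` (`tendsto_recurrence_coeff`).

The type I side is harder: `Q_n(1)` is an explicit factor times the divided difference of
`Γ(x+β+n)/Γ(x+1)` at `t 0, …, t n` (`Q_one`). These divided differences are positive for `n ≠ 0`
with consecutive ratios tending to `1` (`gammaDiff_asymptotics`), so `Q_{n+1}(1)/Q_n(1) → 27/8`. For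
`β < 1` this comes from a series of positive terms and a telescoping estimate; `β = 1` is trivial,
and larger `β` follow by a recurrence in `β`.

Since `27/8` is the inverse of `8/27`, conjugation by `Q_n(1)` and by `B_n(1)` rescales each
diagonal by the same factor in the limit (`tendsto_stochastic_limits`). -/

theorem lowerInv_eq_zero (S : Matrix ℕ ℕ ℝ) {i j : ℕ} (h : i < j) : lowerInv S i j = 0 := by
  rw [lowerInv, dif_neg (by omega)]

theorem sum_lower_extend {L : Matrix ℕ ℕ ℝ} (hL : ∀ i j, i < j → L i j = 0) {i N : ℕ} (h : i < N)
    (f : ℕ → ℝ) : ∑ j ∈ range N, L i j * f j = ∑ j ∈ range (i + 1), L i j * f j := by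
  refine (sum_subset (range_mono (by omega)) fun j _ hj => ?_).symm
  rw [hL i j (by simpa using hj), zero_mul]

theorem lowerInv_mul_of_lt {S : Matrix ℕ ℕ ℝ} (hS : IsLowerUnitriangular S) {i N : ℕ} (h : i < N)
    (k : ℕ) : ∑ j ∈ range N, lowerInv S i j * S j k = if i = k then 1 else 0 := by
  rw [sum_lower_extend (fun _ _ => lowerInv_eq_zero S) h, lowerInv_mul hS]

theorem mul_lowerInv_of_lt {S : Matrix ℕ ℕ ℝ} (hS : IsLowerUnitriangular S) {i N : ℕ} (h : i < N)
    (k : ℕ) : ∑ j ∈ range N, S i j * lowerInv S j k = if i = k then 1 else 0 := by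
  by_cases hk : k < N
  · let A : Matrix (Fin N) (Fin N) ℝ := Matrix.of fun a b => lowerInv S a b
    let M : Matrix (Fin N) (Fin N) ℝ := Matrix.of fun a b => S a b
    have h1 : A * M = 1 := by
      ext a b
      have := lowerInv_mul_of_lt hS a.isLt b
      rw [sum_range] at this
      simp only [Matrix.mul_apply, A, M, Matrix.of_apply, this, Matrix.one_apply, Fin.ext_iff]
    have h2 : M * A = 1 := mul_eq_one_comm.1 h1
    have h3 := congrFun (congrFun h2 ⟨i, h⟩) ⟨k, hk⟩
    simp only [Matrix.mul_apply, A, M, Matrix.of_apply, Matrix.one_apply, Fin.ext_iff] at h3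
    rw [sum_range, h3]
  · rw [if_neg (by omega)]
    exact sum_eq_zero fun j hj => by
      rw [lowerInv_eq_zero S (by have := mem_range.1 hj; omega), mul_zero]

theorem mul_lowerInv {S : Matrix ℕ ℕ ℝ} (hS : IsLowerUnitriangular S) (i k : ℕ) :
    ∑ j ∈ range (i + 1), S i j * lowerInv S j k = if i = k then 1 else 0 :=
  mul_lowerInv_of_lt hS (Nat.lt_succ_self i) k

theorem isLowerUnitriangular_lowerInv {S : Matrix ℕ ℕ ℝ} (hS : IsLowerUnitriangular S) :
    IsLowerUnitriangular (lowerInv S) := by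
  refine ⟨fun i => ?_, fun i j => lowerInv_eq_zero S⟩
  have := lowerInv_mul hS i i
  rw [sum_range_succ, sum_eq_zero, hS.1] at this
  · simpa using this
  · intro j hj
    rw [hS.2 j i (mem_range.1 hj), mul_zero]

/-- A left inverse of `lowerInv S` among the lower triangular matrices is `S`. -/
theorem eq_of_mul_lowerInv {S T : Matrix ℕ ℕ ℝ} (hS : IsLowerUnitriangular S)
    (hT : ∀ i j, i < j → T i j = 0)
    (h : ∀ i k, ∑ j ∈ range (i + 1), T i j * lowerInv S j k = if i = k then 1 else 0) : T = S := by
  ext i k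
  have h1 : ∑ l ∈ range (i + 1), (∑ j ∈ range (i + 1), T i j * lowerInv S j l) * S l k = S i k := by
    simp only [h, ite_mul, one_mul, zero_mul]
    simp
  rw [← h1]
  simp only [sum_mul]
  rw [sum_comm]
  have h2 : ∀ j ∈ range (i + 1), ∑ l ∈ range (i + 1), T i j * lowerInv S j l * S l k
      = T i j * if j = k then 1 else 0 := fun j hj => by
    simp only [mul_assoc, ← mul_sum]
    rw [lowerInv_mul_of_lt hS (mem_range.1 hj)]
  rw [sum_congr rfl h2]
  by_cases hk : k < i + 1
  · simp [mem_range, hk]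
  · rw [hT i k (by omega)]
    simp [mem_range, hk]

theorem lowerInv_lowerInv {S : Matrix ℕ ℕ ℝ} (hS : IsLowerUnitriangular S) :
    lowerInv (lowerInv S) = S :=
  eq_of_mul_lowerInv hS (fun _ _ => lowerInv_eq_zero _)
    fun i k => lowerInv_mul (isLowerUnitriangular_lowerInv hS) i k

theorem lowerInv_inj {S T : Matrix ℕ ℕ ℝ} (hS : IsLowerUnitriangular S)
    (hT : IsLowerUnitriangular T) (h : lowerInv S = lowerInv T) : S = T := by
  rw [← lowerInv_lowerInv hS, h, lowerInv_lowerInv hT]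

/-! ### Gauss–Borel factorizations -/

namespace IsGaussBorel

variable {g : Matrix ℕ ℕ ℝ} {F : Factors}

theorem apply_of_lt (h : IsGaussBorel g F) {i N : ℕ} (hi : i < N) (j : ℕ) :
    g i j = ∑ l ∈ range N, lowerInv F.S i l * (F.H l * lowerInv F.St j l) := by
  rw [sum_lower_extend (fun _ _ => lowerInv_eq_zero F.S) hi, h.2.2.2]
  simp only [mul_assoc]

theorem apply_of_lt' (h : IsGaussBorel g F) {j N : ℕ} (hj : j < N) (i : ℕ) :
    g i j = ∑ l ∈ range N, lowerInv F.St j l * (lowerInv F.S i l * F.H l) := by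
  rw [h.apply_of_lt (show i < max (i + 1) N by simp) j]
  have : ∀ l, lowerInv F.S i l * (F.H l * lowerInv F.St j l)
      = lowerInv F.St j l * (lowerInv F.S i l * F.H l) := fun l => by ring
  simp only [this]
  rw [sum_lower_extend (fun _ _ => lowerInv_eq_zero F.St) (by omega : j < max (i + 1) N),
    sum_lower_extend (fun _ _ => lowerInv_eq_zero F.St) hj]

theorem sum_S_mul (h : IsGaussBorel g F) (n j : ℕ) :
    ∑ i ∈ range (n + 1), F.S n i * g i j = F.H n * lowerInv F.St j n := by
  have h1 : ∀ i ∈ range (n + 1), F.S n i * g i j = ∑ l ∈ range (n + 1),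
      F.S n i * lowerInv F.S i l * (F.H l * lowerInv F.St j l) := fun i hi => by
    rw [h.apply_of_lt (mem_range.1 hi) j, mul_sum]
    exact sum_congr rfl fun _ _ => by ring
  rw [sum_congr rfl h1, sum_comm]
  simp only [← sum_mul, mul_lowerInv h.1, ite_mul, one_mul, zero_mul]
  simp

theorem sum_St_mul (h : IsGaussBorel g F) (n i : ℕ) :
    ∑ j ∈ range (n + 1), F.St n j * g i j = lowerInv F.S i n * F.H n := by
  have h1 : ∀ j ∈ range (n + 1), F.St n j * g i j = ∑ l ∈ range (n + 1),
      F.St n j * lowerInv F.St j l * (lowerInv F.S i l * F.H l) := fun j hj => by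
    rw [h.apply_of_lt' (mem_range.1 hj) i, mul_sum]
    exact sum_congr rfl fun _ _ => by ring
  rw [sum_congr rfl h1, sum_comm]
  simp only [← sum_mul, mul_lowerInv h.2.1, ite_mul, one_mul, zero_mul]
  simp

theorem sum_S_mul_of_lt (h : IsGaussBorel g F) {n j : ℕ} (hj : j < n) :
    ∑ i ∈ range (n + 1), F.S n i * g i j = 0 := by
  rw [h.sum_S_mul, lowerInv_eq_zero _ hj, mul_zero]

theorem sum_S_mul_self (h : IsGaussBorel g F) (n : ℕ) :
    ∑ i ∈ range (n + 1), F.S n i * g i n = F.H n := by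
  rw [h.sum_S_mul, (isLowerUnitriangular_lowerInv h.2.1).1, mul_one]

theorem sum_St_mul_of_le (h : IsGaussBorel g F) {n i : ℕ} (hi : i ≤ n) :
    ∑ j ∈ range (n + 1), (F.H n)⁻¹ * F.St n j * g i j = if i = n then 1 else 0 := by
  simp only [mul_assoc, ← mul_sum]
  rw [h.sum_St_mul]
  have := h.2.2.1 n
  split_ifs with hin
  · rw [hin, (isLowerUnitriangular_lowerInv h.1).1]
    field_simp
  · rw [lowerInv_eq_zero _ (by omega)]
    simp

/-- A vector supported on `0, …, n - 1` that annihilates the columns `0, …, n - 1` vanishes. -/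
theorem eq_zero_of_sum_mul_eq_zero (h : IsGaussBorel g F) {n : ℕ} {d : ℕ → ℝ}
    (hd : ∀ j < n, ∑ i ∈ range n, d i * g i j = 0) {k : ℕ} (hk : k < n) : d k = 0 := by
  -- Combining the columns with the entries of row `l` of `S̃` leaves `(d S⁻¹)_l H_l`, and the pivot
  -- `H_l` cancels.
  have h1 : ∀ l < n, ∑ i ∈ range n, d i * lowerInv F.S i l = 0 := fun l hl => by
    have h2 : ∑ j ∈ range (l + 1), F.St l j * ∑ i ∈ range n, d i * g i j = 0 :=
      sum_eq_zero fun j hj => by rw [hd j (by have := mem_range.1 hj; omega), mul_zero]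
    simp only [mul_sum] at h2
    rw [sum_comm] at h2
    have h3 : ∀ i, ∑ j ∈ range (l + 1), F.St l j * (d i * g i j)
        = d i * lowerInv F.S i l * F.H l := fun i => by
      rw [mul_assoc, ← h.sum_St_mul, mul_sum]
      exact sum_congr rfl fun _ _ => by ring
    simp only [h3, ← sum_mul] at h2
    exact (mul_eq_zero.1 h2).resolve_right (h.2.2.1 l)
  have h2 : ∑ l ∈ range n, (∑ i ∈ range n, d i * lowerInv F.S i l) * F.S l k = 0 :=
    sum_eq_zero fun l hl => by rw [h1 l (mem_range.1 hl), zero_mul]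
  simp only [sum_mul] at h2
  rw [sum_comm] at h2
  have h3 : ∀ i ∈ range n, ∑ l ∈ range n, d i * lowerInv F.S i l * F.S l k
      = d i * if i = k then 1 else 0 := fun i hi => by
    simp only [mul_assoc, ← mul_sum]
    rw [lowerInv_mul_of_lt h.1 (mem_range.1 hi)]
  rw [sum_congr rfl h3] at h2
  simpa [mem_range, hk] using h2

theorem unique {F' : Factors} (h : IsGaussBorel g F) (h' : IsGaussBorel g F') : F = F' := by
  have hS : F.S = F'.S := by
    ext n k
    rcases lt_trichotomy k n with hk | rfl | hk
    -- Both rows end in `1`, so their difference is supported on `0, …, n - 1` and still annihilates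
    -- the first `n` columns.
    · refine sub_eq_zero.1 (h.eq_zero_of_sum_mul_eq_zero (d := fun k => F.S n k - F'.S n k)
        (fun j hj => ?_) hk)
      have h1 := h.sum_S_mul_of_lt hj
      have h2 := h'.sum_S_mul_of_lt hj
      rw [sum_range_succ, h.1.1] at h1
      rw [sum_range_succ, h'.1.1] at h2
      simp only [sub_mul, sum_sub_distrib]
      linarith
    · rw [h.1.1, h'.1.1]
    · rw [h.1.2 n k hk, h'.1.2 n k hk]
  have hH : F.H = F'.H := by
    ext n
    rw [← h.sum_S_mul_self, ← h'.sum_S_mul_self, hS]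
  have hSt : F.St = F'.St := by
    refine lowerInv_inj h.2.1 h'.2.1 ?_
    ext j n
    have h1 := h.sum_S_mul n j
    have h2 := h'.sum_S_mul n j
    rw [← hS, h1, ← hH] at h2
    exact mul_left_cancel₀ (h.2.2.1 n) h2
  exact Factors.ext hS hH hSt

end IsGaussBorel

/-- If `S g` is upper triangular with non-zero diagonal then `g` has a Gauss–Borel
factorization. -/
theorem exists_isGaussBorel {g S : Matrix ℕ ℕ ℝ} (hS : IsLowerUnitriangular S)
    (h0 : ∀ n j, j < n → ∑ i ∈ range (n + 1), S n i * g i j = 0)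
    (hne : ∀ n, ∑ i ∈ range (n + 1), S n i * g i n ≠ 0) : ∃ F, IsGaussBorel g F := by
  set U : ℕ → ℕ → ℝ := fun n j => ∑ i ∈ range (n + 1), S n i * g i j with hU
  -- `U = S g` is upper triangular; dividing its rows by the pivots and transposing gives `S̃⁻¹`.
  let T : Matrix ℕ ℕ ℝ := fun j n => U n j / U n n
  have hT : IsLowerUnitriangular T :=
    ⟨fun i => div_self (hne i), fun i j hij => by simp [T, hU, h0 j i hij]⟩
  refine ⟨⟨S, fun n => U n n, lowerInv T⟩, hS, isLowerUnitriangular_lowerInv hT, hne,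
    fun i j => ?_⟩
  simp only [lowerInv_lowerInv hT]
  have h1 : ∀ l ∈ range (i + 1), lowerInv S i l * U l l * T j l
      = ∑ k ∈ range (i + 1), lowerInv S i l * S l k * g k j := fun l hl => by
    have h2 : lowerInv S i l * U l l * T j l = lowerInv S i l * U l j := by
      have h3 : U l l ≠ 0 := hne l
      simp only [T]
      field_simp
    rw [h2, hU]
    simp only
    rw [← sum_lower_extend hS.2 (mem_range.1 hl), mul_sum]
    exact sum_congr rfl fun _ _ => by ring
  rw [sum_congr rfl h1, sum_comm]
  simp only [← sum_mul, lowerInv_mul hS, ite_mul, one_mul, zero_mul]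
  simp

/-! ### The Hessenberg matrix `S Λ S⁻¹` -/

/-- The Hessenberg matrix `S Λ S⁻¹` of a lower unitriangular matrix. -/
noncomputable def hessOf (S : Matrix ℕ ℕ ℝ) : Matrix ℕ ℕ ℝ := fun n m =>
  ∑ i ∈ range (n + 1), S n i * lowerInv S (i + 1) m

theorem hessOf_succ {S : Matrix ℕ ℕ ℝ} (hS : IsLowerUnitriangular S) (n : ℕ) :
    hessOf S n (n + 1) = 1 := by
  rw [hessOf, sum_range_succ, hS.1, (isLowerUnitriangular_lowerInv hS).1, sum_eq_zero]
  · simp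
  · intro i hi
    rw [lowerInv_eq_zero _ (by have := mem_range.1 hi; omega), mul_zero]

theorem hessOf_eq_zero {S : Matrix ℕ ℕ ℝ} {n m : ℕ} (h : n + 1 < m) :
    hessOf S n m = 0 :=
  sum_eq_zero fun i hi => by
    rw [lowerInv_eq_zero _ (by have := mem_range.1 hi; omega), mul_zero]

theorem sum_hessOf_mul {S : Matrix ℕ ℕ ℝ} (hS : IsLowerUnitriangular S) (n : ℕ) (x : ℝ) :
    ∑ m ∈ range (n + 2), hessOf S n m * ∑ k ∈ range (m + 1), S m k * x ^ k
      = x * ∑ k ∈ range (n + 1), S n k * x ^ k := by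
  have h1 : ∀ m ∈ range (n + 2), hessOf S n m * ∑ k ∈ range (m + 1), S m k * x ^ k
      = ∑ k ∈ range (n + 2), ∑ i ∈ range (n + 1),
        S n i * (lowerInv S (i + 1) m * S m k) * x ^ k := fun m hm => by
    rw [← sum_lower_extend hS.2 (mem_range.1 hm), hessOf, mul_sum]
    refine sum_congr rfl fun k _ => ?_
    rw [sum_mul]
    exact sum_congr rfl fun _ _ => by ring
  rw [sum_congr rfl h1, sum_comm]
  have h2 : ∀ k ∈ range (n + 2), ∑ m ∈ range (n + 2), ∑ i ∈ range (n + 1),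
      S n i * (lowerInv S (i + 1) m * S m k) * x ^ k
      = ∑ i ∈ range (n + 1), S n i * (if i + 1 = k then 1 else 0) * x ^ k := fun k _ => by
    rw [sum_comm]
    refine sum_congr rfl fun i hi => ?_
    rw [← sum_mul, ← mul_sum,
      lowerInv_mul_of_lt hS (by have := mem_range.1 hi; omega)]
  rw [sum_congr rfl h2, sum_comm, mul_sum]
  refine sum_congr rfl fun i hi => ?_
  have : i + 1 < n + 2 := by have := mem_range.1 hi; omega
  simp only [mul_ite, mul_one, mul_zero, ite_mul, zero_mul]
  rw [sum_ite_eq, if_pos (mem_range.2 this)]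
  ring

namespace IsGaussBorel

variable {g : Matrix ℕ ℕ ℝ} {F : Factors}

/-- The symmetry `hg` reads `Λ g = g (Λᵀ)²`, so `S Λ S⁻¹ H = H S̃⁻ᵀ (Λᵀ)² S̃ᵀ`. The right side
vanishes more than two places below the diagonal. -/
theorem hessOf_mul (h : IsGaussBorel g F) (hg : ∀ i j, g (i + 1) j = g i (j + 2)) (n m : ℕ) :
    hessOf F.S n m * F.H m
      = F.H n * ∑ j ∈ range (m + 1), F.St m j * lowerInv F.St (j + 2) n := by
  have h1 : hessOf F.S n m * F.H m
      = ∑ i ∈ range (n + 1), ∑ j ∈ range (m + 1), F.St m j * (F.S n i * g i (j + 2)) := by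
    rw [hessOf, sum_mul]
    refine sum_congr rfl fun i _ => ?_
    rw [mul_assoc, ← h.sum_St_mul, mul_sum]
    exact sum_congr rfl fun j _ => by rw [hg]; ring
  rw [h1, sum_comm, mul_sum]
  refine sum_congr rfl fun j _ => ?_
  rw [← mul_sum, h.sum_S_mul]
  ring

theorem hessOf_eq_zero (h : IsGaussBorel g F) (hg : ∀ i j, g (i + 1) j = g i (j + 2)) {n m : ℕ}
    (hnm : m + 2 < n) : hessOf F.S n m = 0 := by
  have h1 := h.hessOf_mul hg n m
  rw [sum_eq_zero, mul_zero] at h1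
  · exact (mul_eq_zero.1 h1).resolve_right (h.2.2.1 m)
  · intro j hj
    rw [lowerInv_eq_zero _ (by have := mem_range.1 hj; omega), mul_zero]

theorem hessOf_add_two (h : IsGaussBorel g F) (hg : ∀ i j, g (i + 1) j = g i (j + 2)) (m : ℕ) :
    hessOf F.S (m + 2) m = F.H (m + 2) / F.H m := by
  have h1 := h.hessOf_mul hg (m + 2) m
  rw [sum_range_succ, h.2.1.1, (isLowerUnitriangular_lowerInv h.2.1).1, sum_eq_zero] at h1
  · rw [eq_div_iff (h.2.2.1 m), h1]
    ring
  · intro j hj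
    rw [lowerInv_eq_zero _ (by have := mem_range.1 hj; omega), mul_zero]

/-- The four-term recurrence satisfied by the polynomials `S χ`. -/
theorem recurrence (h : IsGaussBorel g F) (hg : ∀ i j, g (i + 1) j = g i (j + 2)) (n : ℕ)
    (x : ℝ) {p : ℕ → ℝ} (hp : ∀ n, p n = ∑ k ∈ range (n + 1), F.S n k * x ^ k) :
    p (n + 3) + hessOf F.S (n + 2) (n + 2) * p (n + 2) + hessOf F.S (n + 2) (n + 1) * p (n + 1)
      + F.H (n + 2) / F.H n * p n = x * p (n + 2) := by
  have h1 := sum_hessOf_mul h.1 (n + 2) x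
  simp only [← hp] at h1
  rw [sum_range_succ, sum_range_succ, sum_range_succ, sum_range_succ, sum_eq_zero,
    hessOf_succ h.1, h.hessOf_add_two hg] at h1
  · linarith
  · intro j hj
    rw [h.hessOf_eq_zero hg (by have := mem_range.1 hj; omega), zero_mul]

end IsGaussBorel

/-! ### The moments -/

theorem integral_rpow_mul_one_sub_rpow {a b : ℝ} (ha : 0 < a) (hb : 0 < b) :
    ∫ x in (0 : ℝ)..1, x ^ (a - 1) * (1 - x) ^ (b - 1)
      = Real.Gamma a * Real.Gamma b / Real.Gamma (a + b) := by
  have h1 := ProbabilityTheory.beta_eq_betaIntegralReal a b ha hb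
  rw [ProbabilityTheory.beta] at h1
  rw [h1, Complex.betaIntegral]
  have h2 : ∫ x in (0 : ℝ)..1, (x : ℂ) ^ ((a : ℂ) - 1) * (1 - (x : ℂ)) ^ ((b : ℂ) - 1)
      = ∫ x in (0 : ℝ)..1, ((x ^ (a - 1) * (1 - x) ^ (b - 1) : ℝ) : ℂ) := by
    refine intervalIntegral.integral_congr fun x hx => ?_
    rw [Set.uIcc_of_le zero_le_one] at hx
    rw [Complex.ofReal_mul, Complex.ofReal_cpow hx.1, Complex.ofReal_cpow (by linarith [hx.2])]
    push_cast
    rfl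
  rw [h2, intervalIntegral.integral_ofReal, Complex.ofReal_re]

theorem Gamma_add_natCast {s : ℝ} (hs : 0 < s) (n : ℕ) :
    Real.Gamma (s + n) = (∏ l ∈ range n, (s + l)) * Real.Gamma s := by
  induction n with
  | zero => simp
  | succ n ih =>
    rw [prod_range_succ, Nat.cast_succ, ← add_assoc, Real.Gamma_add_one (by positivity), ih]
    ring

/-- The exponents of the functions `w₁, w₂, x w₁, x w₂, …`. -/
noncomputable def node (α₁ α₂ : ℝ) (j : ℕ) : ℝ := (j / 2 : ℕ) + if Even j then α₁ else α₂

theorem node_add_two (α₁ α₂ : ℝ) (j : ℕ) : node α₁ α₂ (j + 2) = node α₁ α₂ j + 1 := by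
  have : Even (j + 2) ↔ Even j := by simp [Nat.even_add]
  rw [node, node, if_congr this rfl rfl, Nat.add_div_right j two_pos]
  push_cast
  ring

theorem neg_one_lt_node {α₁ α₂ : ℝ} (h₁ : -1 < α₁) (h₂ : -1 < α₂) (j : ℕ) :
    -1 < node α₁ α₂ j := by
  have : (0 : ℝ) ≤ (j / 2 : ℕ) := by positivity
  rw [node]
  split_ifs <;> linarith

theorem node_injective {α₁ α₂ : ℝ} (h₁₂ : ∀ m : ℤ, α₁ - α₂ ≠ m) :
    Function.Injective (node α₁ α₂) := by
  intro i j hij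
  rw [node, node] at hij
  split_ifs at hij with hi hj hj
  · have : i / 2 = j / 2 := by exact_mod_cast add_right_cancel hij
    have := Nat.even_iff.1 hi
    have := Nat.even_iff.1 hj
    omega
  · refine absurd ?_ (h₁₂ (((j / 2 : ℕ) : ℤ) - ((i / 2 : ℕ) : ℤ)))
    rw [Int.cast_sub, Int.cast_natCast, Int.cast_natCast]
    linarith
  · refine absurd ?_ (h₁₂ (((i / 2 : ℕ) : ℤ) - ((j / 2 : ℕ) : ℤ)))
    rw [Int.cast_sub, Int.cast_natCast, Int.cast_natCast]
    linarith
  · have : i / 2 = j / 2 := by exact_mod_cast add_right_cancel hij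
    have := Nat.not_even_iff.1 hi
    have := Nat.not_even_iff.1 hj
    omega

theorem abs_node_sub_le (α₁ α₂ : ℝ) (n : ℕ) :
    |node α₁ α₂ n - n / 2| ≤ |α₁| + |α₂| + 1 := by
  have h3 : ((n / 2 : ℕ) : ℝ) ≤ n / 2 := Nat.cast_div_le
  have h4 : (n : ℝ) / 2 ≤ (n / 2 : ℕ) + 1 := by
    have : n ≤ 2 * (n / 2) + 2 := by omega
    have : (n : ℝ) ≤ 2 * (n / 2 : ℕ) + 2 := by exact_mod_cast this
    linarith
  have h5 := abs_nonneg α₁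
  have h6 := abs_nonneg α₂
  rw [node, abs_le]
  split_ifs
  · constructor <;> linarith [le_abs_self α₁, neg_abs_le α₁]
  · constructor <;> linarith [le_abs_self α₂, neg_abs_le α₂]

theorem tendsto_node_div (α₁ α₂ : ℝ) :
    Tendsto (fun n : ℕ => node α₁ α₂ n / n) atTop (𝓝 (1 / 2)) := by
  rw [← tendsto_sub_nhds_zero_iff]
  refine squeeze_zero_norm' ?_ (tendsto_const_div_atTop_nhds_zero_nat (|α₁| + |α₂| + 1))
  filter_upwards [eventually_gt_atTop 0] with n hn
  have hn' : (0 : ℝ) < n := by exact_mod_cast hn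
  have h2 : node α₁ α₂ n / n - 1 / 2 = (node α₁ α₂ n - n / 2) / n := by field_simp
  rw [h2, norm_div, Real.norm_natCast, Real.norm_eq_abs]
  gcongr
  exact abs_node_sub_le α₁ α₂ n

theorem moment_succ (α₀ α₁ α₂ : ℝ) (i j : ℕ) :
    moment α₀ α₁ α₂ (i + 1) j = moment α₀ α₁ α₂ i (j + 2) := by
  have : Even (j + 2) ↔ Even j := by simp [Nat.even_add]
  simp only [moment, xi, Nat.add_div_right j two_pos, this]
  congr 1
  ext x
  ring

theorem moment_eq {α₀ α₁ α₂ : ℝ} (h₀ : -1 < α₀) (h₁ : -1 < α₁) (h₂ : -1 < α₂) (i j : ℕ) :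
    moment α₀ α₁ α₂ i j = Real.Gamma (α₀ + 1) * Real.Gamma (node α₁ α₂ j + 1 + i)
      / Real.Gamma (node α₁ α₂ j + (α₀ + 1) + 1 + i) := by
  have ht := neg_one_lt_node h₁ h₂ j
  have hi : (0 : ℝ) ≤ i := Nat.cast_nonneg i
  have h := integral_rpow_mul_one_sub_rpow (a := node α₁ α₂ j + 1 + i) (b := α₀ + 1)
    (by linarith) (by linarith)
  rw [mul_comm (Real.Gamma (α₀ + 1)), show node α₁ α₂ j + (α₀ + 1) + 1 + (i : ℝ)
    = node α₁ α₂ j + 1 + i + (α₀ + 1) by ring, ← h, moment]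
  -- The integrands are compared on `(0, 1]` only: splitting the real power needs `0 < x`.
  refine intervalIntegral.integral_congr_ae (Eventually.of_forall fun x hx => ?_)
  rw [Set.uIoc_of_le zero_le_one] at hx
  have h3 : node α₁ α₂ j + 1 + i - 1 = (i : ℕ) + ((j / 2 : ℕ) + if Even j then α₁ else α₂) := by
    rw [node]; ring
  rw [h3, Real.rpow_add hx.1, Real.rpow_add hx.1, Real.rpow_natCast, Real.rpow_natCast,
    add_sub_cancel_right, xi]
  split_ifs <;> ring

/-! ### Mellin transforms of polynomials -/

/-- Up to a factor that does not depend on `i`, the Mellin transform of `x ^ i` with respect to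
`(1 - x) ^ (β - 1) dx`, as a polynomial of degree `n`. -/
noncomputable def mellinBasis (β : ℝ) (n i : ℕ) : ℝ[X] :=
  (∏ l ∈ range i, (X + C (1 + (l : ℝ)))) * ∏ l ∈ Ico i n, (X + C (β + 1 + (l : ℝ)))

/-- The Mellin transform of the polynomial `∑ c i x ^ i`, normalized as in `mellinBasis`. -/
noncomputable def mellin (β : ℝ) (n : ℕ) (c : ℕ → ℝ) : ℝ[X] :=
  ∑ i ∈ range (n + 1), C (c i) * mellinBasis β n i

theorem mellinBasis_succ (β : ℝ) {n i : ℕ} (h : i ≤ n) :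
    mellinBasis β (n + 1) i = mellinBasis β n i * (X + C (β + 1 + (n : ℝ))) := by
  rw [mellinBasis, mellinBasis, prod_Ico_succ_top h]
  ring

theorem mellinBasis_monic (β : ℝ) (n i : ℕ) : (mellinBasis β n i).Monic :=
  (monic_prod_of_monic _ _ fun _ _ => monic_X_add_C _).mul
    (monic_prod_of_monic _ _ fun _ _ => monic_X_add_C _)

theorem natDegree_mellinBasis (β : ℝ) {n i : ℕ} (h : i ≤ n) :
    (mellinBasis β n i).natDegree = n := by
  rw [mellinBasis, (monic_prod_of_monic _ _ fun _ _ => monic_X_add_C _).natDegree_mul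
    (monic_prod_of_monic _ _ fun _ _ => monic_X_add_C _),
    natDegree_prod_of_monic _ _ fun _ _ => monic_X_add_C _,
    natDegree_prod_of_monic _ _ fun _ _ => monic_X_add_C _]
  simp only [natDegree_X_add_C, sum_const, card_range, Nat.card_Ico, smul_eq_mul, mul_one]
  omega

theorem natDegree_mellin_le (β : ℝ) (n : ℕ) (c : ℕ → ℝ) : (mellin β n c).natDegree ≤ n :=
  natDegree_sum_le_of_forall_le _ _ fun _ hi =>
    (natDegree_C_mul_le _ _).trans (natDegree_mellinBasis β (Nat.lt_succ_iff.1 (mem_range.1 hi))).le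

theorem coeff_mellin (β : ℝ) (n : ℕ) (c : ℕ → ℝ) :
    (mellin β n c).coeff n = ∑ i ∈ range (n + 1), c i := by
  rw [mellin, finsetSum_coeff]
  refine sum_congr rfl fun i hi => ?_
  have h1 := natDegree_mellinBasis β (Nat.lt_succ_iff.1 (mem_range.1 hi))
  have h2 := (mellinBasis_monic β n i).coeff_natDegree
  rw [h1] at h2
  rw [coeff_C_mul, h2, mul_one]

theorem eval_mellinBasis_eq_zero (β : ℝ) {n i : ℕ} (h : i < n) :
    (mellinBasis β n i).eval (-(β + n)) = 0 := by
  rw [mellinBasis, eval_mul, eval_prod (Ico i n), prod_eq_zero (s := Ico i n) (i := n - 1),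
    mul_zero]
  · rw [mem_Ico]; omega
  · rw [eval_add, eval_X, eval_C, Nat.cast_sub (by omega)]
    push_cast
    ring

theorem eval_mellinBasis_self (β : ℝ) (n : ℕ) :
    (mellinBasis β n n).eval (-(β + n)) = (-1) ^ n * ∏ l ∈ range n, (β + l) := by
  rw [mellinBasis, Ico_self, prod_empty, mul_one, eval_prod, ← prod_range_reflect]
  have : (-1 : ℝ) ^ n = ∏ l ∈ range n, (-1 : ℝ) := by simp
  rw [this, ← prod_mul_distrib]
  refine prod_congr rfl fun l hl => ?_
  have := mem_range.1 hl
  rw [eval_add, eval_X, eval_C, Nat.sub_sub, Nat.cast_sub (by omega)]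
  push_cast
  ring

/-- At `-(β + n)` the factor with `l = n - 1` kills every basis element except the last, so this
value reads off the top coefficient `c n`. -/
theorem eval_mellin_neg_add (β : ℝ) (n : ℕ) (c : ℕ → ℝ) :
    (mellin β n c).eval (-(β + n)) = c n * ((-1) ^ n * ∏ l ∈ range n, (β + l)) := by
  rw [mellin, eval_finsetSum, sum_range_succ, sum_eq_zero, zero_add, eval_C_mul,
    eval_mellinBasis_self]
  intro i hi
  rw [eval_C_mul, eval_mellinBasis_eq_zero β (mem_range.1 hi), mul_zero]

/-- At `-1` the factor with `l = 0` kills every basis element with `i > 0`, so this value reads off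
`c 0`. -/
theorem eval_mellin_neg_one (β : ℝ) (n : ℕ) (c : ℕ → ℝ) :
    (mellin β n c).eval (-1) = c 0 * ∏ l ∈ range n, (β + l) := by
  rw [mellin, eval_finsetSum, sum_range_succ', sum_eq_zero, zero_add, eval_C_mul]
  · rw [mellinBasis, range_zero, prod_empty, one_mul, eval_prod, range_eq_Ico]
    congr 1
    exact prod_congr rfl fun l _ => by simp; ring
  · intro i _
    rw [eval_C_mul, mellinBasis, eval_mul, eval_prod, prod_eq_zero (i := 0) (by simp) (by simp)]
    simp

theorem exists_mellin_eq {β : ℝ} (hβ : 0 < β) (n : ℕ) {q : ℝ[X]} (hq : q.natDegree ≤ n) :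
    ∃ c : ℕ → ℝ, mellin β n c = q := by
  induction n generalizing q with
  | zero =>
    refine ⟨fun _ => q.coeff 0, ?_⟩
    rw [eq_C_of_natDegree_le_zero hq]
    simp [mellin, mellinBasis]
  | succ n ih =>
    have hP : ∏ l ∈ range (n + 1), (β + (l : ℝ)) ≠ 0 :=
      prod_ne_zero_iff.2 fun l _ => by positivity
    -- This multiple of the last basis element makes the difference vanish at `-(β + n + 1)`; the
    -- root can be divided out because all other basis elements contain the same linear factor.
    set a : ℝ := q.eval (-(β + (n + 1 : ℕ))) / ((-1) ^ (n + 1) * ∏ l ∈ range (n + 1), (β + (l : ℝ)))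
    have h1 : (q - C a * mellinBasis β (n + 1) (n + 1)).IsRoot (-(β + (n + 1 : ℕ))) := by
      rw [IsRoot.def, eval_sub, eval_C_mul, eval_mellinBasis_self, div_mul_cancel₀, sub_self]
      exact mul_ne_zero (by simp) hP
    obtain ⟨r, hr⟩ := dvd_iff_isRoot.2 h1
    have h2 : (q - C a * mellinBasis β (n + 1) (n + 1)).natDegree ≤ n + 1 :=
      (natDegree_sub_le _ _).trans (max_le hq ((natDegree_C_mul_le _ _).trans
        (natDegree_mellinBasis β le_rfl).le))
    have h3 : r.natDegree ≤ n := by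
      by_cases h0 : r = 0
      · simp [h0]
      · rw [hr, natDegree_mul (X_sub_C_ne_zero _) h0, natDegree_X_sub_C] at h2
        omega
    obtain ⟨c, hc⟩ := ih h3
    refine ⟨fun i => if i = n + 1 then a else c i, ?_⟩
    rw [mellin, sum_range_succ, if_pos rfl]
    have h4 : ∑ i ∈ range (n + 1), C (if i = n + 1 then a else c i) * mellinBasis β (n + 1) i
        = r * (X - C (-(β + (n + 1 : ℕ)))) := by
      rw [← hc, mellin, sum_mul]
      refine sum_congr rfl fun i hi => ?_
      have hi' := mem_range.1 hi
      rw [if_neg (by omega), mellinBasis_succ β (by omega)]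
      simp only [map_neg, map_add, Nat.cast_add, Nat.cast_one]
      ring
    rw [h4, mul_comm, ← hr]
    ring

/-- `Γ(t+1+i)` and `Γ(t+β+1+i)` differ from `Γ(t+1)` and `Γ(t+β+1+n)` by products of linear factors
in `t`; over a common denominator these are the `mellinBasis` polynomials. -/
theorem sum_mul_moment {α₀ α₁ α₂ : ℝ} (h₀ : -1 < α₀) (h₁ : -1 < α₁) (h₂ : -1 < α₂) (n j : ℕ)
    (c : ℕ → ℝ) :
    ∑ i ∈ range (n + 1), c i * moment α₀ α₁ α₂ i j
      = Real.Gamma (α₀ + 1) * Real.Gamma (node α₁ α₂ j + 1)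
        / Real.Gamma (node α₁ α₂ j + (α₀ + 1) + 1 + n)
        * (mellin (α₀ + 1) n c).eval (node α₁ α₂ j) := by
  rw [mellin, eval_finsetSum, mul_sum]
  refine sum_congr rfl fun i hi => ?_
  have hin : i ≤ n := Nat.lt_succ_iff.1 (mem_range.1 hi)
  have ht := neg_one_lt_node h₁ h₂ j
  set t := node α₁ α₂ j with ht'
  set β := α₀ + 1 with hβ'
  have hβ : 0 < β := by simp only [β]; linarith
  have hs : 0 < t + β + 1 := by linarith
  rw [moment_eq h₀ h₁ h₂, ← ht', ← hβ', Gamma_add_natCast (by linarith : 0 < t + 1), eval_C_mul,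
    mellinBasis, eval_mul, eval_prod, eval_prod, Gamma_add_natCast hs, Gamma_add_natCast hs,
    ← prod_range_mul_prod_Ico _ hin]
  simp only [eval_add, eval_X, eval_C]
  have e1 : ∏ l ∈ range i, (t + (1 + (l : ℝ))) = ∏ l ∈ range i, (t + 1 + l) :=
    prod_congr rfl fun _ _ => by ring
  have e2 : ∏ l ∈ Ico i n, (t + (β + 1 + (l : ℝ))) = ∏ l ∈ Ico i n, (t + β + 1 + l) :=
    prod_congr rfl fun _ _ => by ring
  rw [e1, e2]
  have n1 : ∏ l ∈ range i, (t + β + 1 + (l : ℝ)) ≠ 0 := prod_ne_zero_iff.2 fun l _ => by positivity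
  have n2 : ∏ l ∈ Ico i n, (t + β + 1 + (l : ℝ)) ≠ 0 := prod_ne_zero_iff.2 fun l _ => by positivity
  have n3 := (Real.Gamma_pos_of_pos hs).ne'
  field_simp

/-! ### Explicit expressions for the factors -/

/-- The value at `1` of the type II polynomial of degree `n`. -/
noncomputable def typeIIAtOne (β : ℝ) (t : ℕ → ℝ) (n : ℕ) : ℝ :=
  (∏ l ∈ range n, (β + l)) / ∏ j ∈ range n, (β + n + t j)

theorem pochhammer_pos {β : ℝ} (hβ : 0 < β) (n : ℕ) : 0 < ∏ l ∈ range n, (β + (l : ℝ)) :=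
  prod_pos fun l _ => by positivity

/-- The hypothesis `h` excludes only a nonempty product at `n = 0`, where `β + t j` can be negative.
-/
theorem prod_add_node_pos {β : ℝ} (hβ : 0 < β) {t : ℕ → ℝ} (ht : ∀ j, -1 < t j) {n : ℕ}
    {s : Finset ℕ} (h : s.Nonempty → n ≠ 0) : 0 < ∏ j ∈ s, (β + n + t j) :=
  prod_pos fun j hj => by
    have h1 : (1 : ℝ) ≤ n := by
      exact_mod_cast Nat.one_le_iff_ne_zero.2 (h ⟨j, hj⟩)
    linarith [ht j]

theorem range_nonempty_imp {n : ℕ} (h : (range n).Nonempty) : n ≠ 0 := by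
  rintro rfl
  simp at h

theorem typeIIAtOne_pos {β : ℝ} (hβ : 0 < β) {t : ℕ → ℝ} (ht : ∀ j, -1 < t j) (n : ℕ) :
    0 < typeIIAtOne β t n :=
  div_pos (pochhammer_pos hβ n) (prod_add_node_pos hβ ht range_nonempty_imp)

theorem eval_neg_prod_X_sub_C (x : ℝ) (t : ℕ → ℝ) (s : Finset ℕ) :
    (∏ j ∈ s, (X - C (t j))).eval (-x) = (-1) ^ #s * ∏ j ∈ s, (x + t j) := by
  rw [eval_prod, ← prod_const, ← prod_mul_distrib]
  refine prod_congr rfl fun j _ => ?_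
  rw [eval_sub, eval_X, eval_C]
  ring

theorem eval_prod_X_sub_C (x : ℝ) (t : ℕ → ℝ) (s : Finset ℕ) :
    (∏ j ∈ s, (X - C (t j))).eval x = ∏ j ∈ s, (x - t j) := by
  simp [eval_prod]

theorem natDegree_prod_range_X_sub_C (t : ℕ → ℝ) (s : Finset ℕ) :
    (∏ j ∈ s, (X - C (t j))).natDegree = #s := by
  simp

theorem mellin_eq_of_orthogonal {β : ℝ} (hβ : 0 < β) {t : ℕ → ℝ} (ht : ∀ j, -1 < t j)
    (hinj : Function.Injective t) {n : ℕ} {c : ℕ → ℝ} (hc : c n = 1)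
    (h : ∀ j < n, (mellin β n c).eval (t j) = 0) :
    mellin β n c = C (typeIIAtOne β t n) * ∏ j ∈ range n, (X - C (t j)) := by
  set N : ℝ[X] := ∏ j ∈ range n, (X - C (t j)) with hN
  have hNm : N.Monic := monic_prod_X_sub_C _ _
  have hNd : N.natDegree = n := by rw [hN, natDegree_prod_range_X_sub_C, card_range]
  set a := (mellin β n c).coeff n
  have h1 : mellin β n c - C a * N = 0 := by
    refine eq_zero_of_degree_lt_of_eval_index_eq_zero (s := range n) (v := t) hinj.injOn ?_ ?_
    · rw [card_range, degree_lt_iff_coeff_zero]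
      intro m hm
      rcases hm.eq_or_lt with rfl | hm
      · rw [coeff_sub, coeff_C_mul]
        have := hNm.coeff_natDegree
        rw [hNd] at this
        rw [this, mul_one, sub_self]
      · rw [coeff_sub, coeff_C_mul, coeff_eq_zero_of_natDegree_lt (by omega : N.natDegree < m),
          coeff_eq_zero_of_natDegree_lt ((natDegree_mellin_le β n c).trans_lt hm)]
        simp
    · intro j hj
      rw [eval_sub, h j (mem_range.1 hj), eval_C_mul, hN, eval_prod, prod_eq_zero hj (by simp)]
      simp
  rw [sub_eq_zero] at h1
  -- The multiple `a` is determined by `c n = 1`, which is visible at `-(β + n)`.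
  have h2 := congrArg (eval (-(β + n))) h1
  rw [eval_mellin_neg_add, hc, one_mul, eval_C_mul, hN, eval_neg_prod_X_sub_C, card_range,
    mul_left_comm] at h2
  have h3 := mul_left_cancel₀ (by simp) h2
  have h4 : a = typeIIAtOne β t n := by
    rw [typeIIAtOne, h3, mul_div_cancel_right₀ _ (prod_add_node_pos hβ ht range_nonempty_imp).ne']
  rw [h1, h4]

section

variable {α₀ α₁ α₂ : ℝ}

theorem moment_factor_pos (h₀ : -1 < α₀) (h₁ : -1 < α₁) (h₂ : -1 < α₂) (n j : ℕ) :
    0 < Real.Gamma (α₀ + 1) * Real.Gamma (node α₁ α₂ j + 1)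
        / Real.Gamma (node α₁ α₂ j + (α₀ + 1) + 1 + n) := by
  have := neg_one_lt_node h₁ h₂ j
  have hn : (0 : ℝ) ≤ n := n.cast_nonneg
  exact div_pos (mul_pos (Real.Gamma_pos_of_pos (by linarith)) (Real.Gamma_pos_of_pos (by linarith)))
    (Real.Gamma_pos_of_pos (by linarith))

theorem exists_isGaussBorel_moment (h₀ : -1 < α₀) (h₁ : -1 < α₁) (h₂ : -1 < α₂)
    (h₁₂ : ∀ m : ℤ, α₁ - α₂ ≠ m) : ∃ F, IsGaussBorel (moment α₀ α₁ α₂) F := by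
  have hβ : 0 < α₀ + 1 := by linarith
  have ht := neg_one_lt_node h₁ h₂
  set t := node α₁ α₂ with ht'
  have hex : ∀ n, ∃ c : ℕ → ℝ, mellin (α₀ + 1) n c
      = C (typeIIAtOne (α₀ + 1) t n) * ∏ j ∈ range n, (X - C (t j)) := fun n =>
    exists_mellin_eq hβ n ((natDegree_C_mul_le _ _).trans (by simp))
  choose c hc using hex
  have hcn : ∀ n, c n n = 1 := fun n => by
    have h := congrArg (eval (-(α₀ + 1 + n))) (hc n)
    rw [eval_mellin_neg_add, eval_C_mul, eval_neg_prod_X_sub_C, card_range, mul_left_comm,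
      mul_left_comm _ ((-1 : ℝ) ^ n), typeIIAtOne,
      div_mul_cancel₀ _ (prod_add_node_pos hβ ht range_nonempty_imp).ne'] at h
    have h := mul_left_cancel₀ (by simp) h
    exact (mul_eq_right₀ (pochhammer_pos hβ n).ne').1 h
  have hsum : ∀ n j, ∑ i ∈ range (n + 1), (if i ≤ n then c n i else 0) * moment α₀ α₁ α₂ i j
      = ∑ i ∈ range (n + 1), c n i * moment α₀ α₁ α₂ i j := fun n j =>
    sum_congr rfl fun i hi => by rw [if_pos (Nat.lt_succ_iff.1 (mem_range.1 hi))]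
  -- `mellin` does not see `c n i` for `i > n`, so these values are arbitrary and have to be cut
  -- off.
  refine exists_isGaussBorel (S := fun n i => if i ≤ n then c n i else 0)
    ⟨fun n => by simp [hcn], fun n i hni => if_neg (by omega)⟩ (fun n j hj => ?_) fun n => ?_
  · rw [hsum, sum_mul_moment h₀ h₁ h₂, hc, eval_C_mul, eval_prod_X_sub_C,
      prod_eq_zero (mem_range.2 hj) (by simp [ht'])]
    simp
  · rw [hsum, sum_mul_moment h₀ h₁ h₂, hc, eval_C_mul, eval_prod_X_sub_C]
    refine mul_ne_zero (moment_factor_pos h₀ h₁ h₂ n n).ne'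
      (mul_ne_zero (typeIIAtOne_pos hβ ht n).ne' (prod_ne_zero_iff.2 fun j hj => ?_))
    exact sub_ne_zero.2 fun h => (mem_range.1 hj).ne' (node_injective h₁₂ h)

theorem isGaussBorel_factors (h₀ : -1 < α₀) (h₁ : -1 < α₁) (h₂ : -1 < α₂)
    (h₁₂ : ∀ m : ℤ, α₁ - α₂ ≠ m) : IsGaussBorel (moment α₀ α₁ α₂) (factors α₀ α₁ α₂) :=
  Classical.epsilon_spec (exists_isGaussBorel_moment h₀ h₁ h₂ h₁₂)

theorem mellin_factors (h₀ : -1 < α₀) (h₁ : -1 < α₁) (h₂ : -1 < α₂)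
    (h₁₂ : ∀ m : ℤ, α₁ - α₂ ≠ m) (n : ℕ) :
    mellin (α₀ + 1) n ((factors α₀ α₁ α₂).S n)
      = C (typeIIAtOne (α₀ + 1) (node α₁ α₂) n) * ∏ j ∈ range n, (X - C (node α₁ α₂ j)) := by
  have hF := isGaussBorel_factors h₀ h₁ h₂ h₁₂
  refine mellin_eq_of_orthogonal (by linarith) (neg_one_lt_node h₁ h₂) (node_injective h₁₂)
    (hF.1.1 n) fun j hj => ?_
  have h := hF.sum_S_mul_of_lt hj
  rw [sum_mul_moment h₀ h₁ h₂] at h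
  exact (mul_eq_zero.1 h).resolve_left (moment_factor_pos h₀ h₁ h₂ n j).ne'

theorem B_one (h₀ : -1 < α₀) (h₁ : -1 < α₁) (h₂ : -1 < α₂)
    (h₁₂ : ∀ m : ℤ, α₁ - α₂ ≠ m) (n : ℕ) :
    B α₀ α₁ α₂ n 1 = typeIIAtOne (α₀ + 1) (node α₁ α₂) n := by
  have h := coeff_mellin (α₀ + 1) n ((factors α₀ α₁ α₂).S n)
  have h3 := (monic_prod_X_sub_C (node α₁ α₂) (range n)).coeff_natDegree
  rw [natDegree_prod_range_X_sub_C, card_range] at h3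
  rw [mellin_factors h₀ h₁ h₂ h₁₂, coeff_C_mul, h3, mul_one] at h
  simp [B, h]

theorem B_zero (h₀ : -1 < α₀) (h₁ : -1 < α₁) (h₂ : -1 < α₂)
    (h₁₂ : ∀ m : ℤ, α₁ - α₂ ≠ m) (n : ℕ) :
    B α₀ α₁ α₂ n 0 = typeIIAtOne (α₀ + 1) (node α₁ α₂) n
      * ((-1) ^ n * ∏ j ∈ range n, (1 + node α₁ α₂ j)) / ∏ l ∈ range n, (α₀ + 1 + l) := by
  have h := eval_mellin_neg_one (α₀ + 1) n ((factors α₀ α₁ α₂).S n)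
  rw [mellin_factors h₀ h₁ h₂ h₁₂, eval_C_mul, eval_neg_prod_X_sub_C, card_range] at h
  rw [eq_div_iff (pochhammer_pos (by linarith) n).ne', h, B, sum_range_succ', sum_eq_zero]
  · simp
  · simp

theorem factors_H (h₀ : -1 < α₀) (h₁ : -1 < α₁) (h₂ : -1 < α₂)
    (h₁₂ : ∀ m : ℤ, α₁ - α₂ ≠ m) (n : ℕ) :
    (factors α₀ α₁ α₂).H n = Real.Gamma (α₀ + 1) * Real.Gamma (node α₁ α₂ n + 1)
      / Real.Gamma (node α₁ α₂ n + (α₀ + 1) + 1 + n)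
      * (typeIIAtOne (α₀ + 1) (node α₁ α₂) n
        * ∏ j ∈ range n, (node α₁ α₂ n - node α₁ α₂ j)) := by
  rw [← (isGaussBorel_factors h₀ h₁ h₂ h₁₂).sum_S_mul_self, sum_mul_moment h₀ h₁ h₂,
    mellin_factors h₀ h₁ h₂ h₁₂, eval_C_mul, eval_prod_X_sub_C]

theorem xi_one (j : ℕ) : xi α₁ α₂ j 1 = 1 := by simp [xi]

/-- The form is tested against the polynomial `∑ c i x ^ i` whose Mellin polynomial vanishes at all
nodes `t k`, `k ≤ n`, except `t j`. The pairing keeps only the `j`-th coefficient, and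
biorthogonality says that it equals `c n`. -/
theorem type_I_coeff (h₀ : -1 < α₀) (h₁ : -1 < α₁) (h₂ : -1 < α₂)
    (h₁₂ : ∀ m : ℤ, α₁ - α₂ ≠ m) {n j : ℕ} (hj : j ∈ range (n + 1)) :
    ((factors α₀ α₁ α₂).H n)⁻¹ * (factors α₀ α₁ α₂).St n j
      = Real.Gamma (node α₁ α₂ j + (α₀ + 1) + 1 + n) / Real.Gamma (node α₁ α₂ j + 1)
        / (∏ k ∈ (range (n + 1)).erase j, (node α₁ α₂ j - node α₁ α₂ k))
        * ((∏ k ∈ (range (n + 1)).erase j, (α₀ + 1 + n + node α₁ α₂ k))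
          / ((∏ l ∈ range n, (α₀ + 1 + l)) * Real.Gamma (α₀ + 1))) := by
  have hβ : 0 < α₀ + 1 := by linarith
  have hF := isGaussBorel_factors h₀ h₁ h₂ h₁₂
  have ht := neg_one_lt_node h₁ h₂
  have hinj := node_injective h₁₂
  set t := node α₁ α₂ with ht'
  set a : ℕ → ℝ := fun k => ((factors α₀ α₁ α₂).H n)⁻¹ * (factors α₀ α₁ α₂).St n k with ha
  set E := (range (n + 1)).erase j with hE
  have hcard : #E = n := by rw [hE, card_erase_of_mem hj, card_range, Nat.add_sub_cancel]
  obtain ⟨c, hc⟩ := exists_mellin_eq hβ n (q := ∏ k ∈ E, (X - C (t k))) (by simp [hcard])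
  have hP := (pochhammer_pos hβ n).ne'
  have hcn : c n = (∏ k ∈ E, (α₀ + 1 + n + t k)) / ∏ l ∈ range n, (α₀ + 1 + l) := by
    have h := eval_mellin_neg_add (α₀ + 1) n c
    rw [hc, eval_neg_prod_X_sub_C, hcard, mul_left_comm] at h
    rw [eq_div_iff hP]
    exact (mul_left_cancel₀ (by simp) h).symm
  have h3 : ∑ i ∈ range (n + 1), c i * ∑ k ∈ range (n + 1), a k * moment α₀ α₁ α₂ i k = c n := by
    have : ∀ i ∈ range (n + 1), c i * ∑ k ∈ range (n + 1), a k * moment α₀ α₁ α₂ i k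
        = c i * if i = n then 1 else 0 := fun i hi => by
      rw [hF.sum_St_mul_of_le (Nat.lt_succ_iff.1 (mem_range.1 hi))]
    rw [sum_congr rfl this]
    simp
  have h4 : ∑ i ∈ range (n + 1), c i * ∑ k ∈ range (n + 1), a k * moment α₀ α₁ α₂ i k
      = ∑ k ∈ range (n + 1), a k * ∑ i ∈ range (n + 1), c i * moment α₀ α₁ α₂ i k := by
    simp only [mul_sum]
    rw [sum_comm]
    exact sum_congr rfl fun _ _ => sum_congr rfl fun _ _ => by ring
  have h5 : ∀ k ∈ E, a k * ∑ i ∈ range (n + 1), c i * moment α₀ α₁ α₂ i k = 0 := fun k hk => by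
    rw [sum_mul_moment h₀ h₁ h₂, hc, eval_prod_X_sub_C, prod_eq_zero hk (by simp [ht'])]
    simp
  rw [h4, ← add_sum_erase _ _ hj, sum_eq_zero h5, add_zero, sum_mul_moment h₀ h₁ h₂, hc,
    eval_prod_X_sub_C, ← ht', hcn] at h3
  · have n1 : ∏ k ∈ E, (t j - t k) ≠ 0 := prod_ne_zero_iff.2 fun k hk =>
      sub_ne_zero.2 fun h => (ne_of_mem_erase hk) (hinj h).symm
    have n2 := (Real.Gamma_pos_of_pos hβ).ne'
    have n3 := (Real.Gamma_pos_of_pos (by linarith [ht j] : 0 < t j + 1)).ne'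
    have n4 := (Real.Gamma_pos_of_pos
      (by linarith [ht j, n.cast_nonneg (α := ℝ)] : 0 < t j + (α₀ + 1) + 1 + n)).ne'
    change a j = _
    field_simp at h3 ⊢
    linarith

/-- The divided difference of `f` at the nodes `t 0, …, t n`. -/
noncomputable def dividedDiff (t : ℕ → ℝ) (f : ℝ → ℝ) (n : ℕ) : ℝ :=
  ∑ j ∈ range (n + 1), f (t j) / ∏ k ∈ (range (n + 1)).erase j, (t j - t k)

/-- One factor `t j + β + n` of the Gamma function completes the product over `k ≠ j` to one that
does not depend on `j`, leaving a divided difference. For `n = 0` this factor need not be positive,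
and `Q_zero_one_pos` is used instead. -/
theorem Q_one (h₀ : -1 < α₀) (h₁ : -1 < α₁) (h₂ : -1 < α₂)
    (h₁₂ : ∀ m : ℤ, α₁ - α₂ ≠ m) {n : ℕ} (hn : n ≠ 0) :
    Q α₀ α₁ α₂ n 1
      = dividedDiff (node α₁ α₂) (fun t => Real.Gamma (t + (α₀ + 1 + n)) / Real.Gamma (t + 1)) n
        * ((α₀ + 1 + n + node α₁ α₂ n)
          / (typeIIAtOne (α₀ + 1) (node α₁ α₂) n * Real.Gamma (α₀ + 1))) := by
  have hβ : 0 < α₀ + 1 := by linarith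
  have ht := neg_one_lt_node h₁ h₂
  set t := node α₁ α₂ with ht'
  rw [Q, mul_sum, dividedDiff, sum_mul]
  refine sum_congr rfl fun j hj => ?_
  have hpos : 0 < t j + (α₀ + 1) + n := by
    have : (1 : ℝ) ≤ n := by exact_mod_cast Nat.one_le_iff_ne_zero.2 hn
    linarith [ht j]
  rw [xi_one, mul_one, type_I_coeff h₀ h₁ h₂ h₁₂ hj, ← ht',
    show t j + (α₀ + 1) + 1 + (n : ℝ) = t j + (α₀ + 1) + n + 1 by ring,
    Real.Gamma_add_one hpos.ne', add_assoc (t j), typeIIAtOne]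
  have h1 := mul_prod_erase (range (n + 1)) (fun k => α₀ + 1 + n + t k) hj
  rw [prod_range_succ] at h1
  have n1 := (prod_add_node_pos hβ ht (n := n) range_nonempty_imp).ne'
  have n2 := (Real.Gamma_pos_of_pos hβ).ne'
  have hP := (pochhammer_pos hβ n).ne'
  generalize ∏ k ∈ (range (n + 1)).erase j, (α₀ + 1 + n + t k) = E at h1 ⊢
  generalize ∏ k ∈ (range (n + 1)).erase j, (t j - t k) = D
  generalize ∏ k ∈ range n, (α₀ + 1 + n + t k) = N at h1 n1 ⊢
  have h2 : (α₀ + 1 + n + t n) = (α₀ + 1 + n + t j) * E / N := by rw [h1]; field_simp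
  rw [h2]
  field_simp
  ring

theorem Q_zero_one_pos (h₀ : -1 < α₀) (h₁ : -1 < α₁) (h₂ : -1 < α₂)
    (h₁₂ : ∀ m : ℤ, α₁ - α₂ ≠ m) : 0 < Q α₀ α₁ α₂ 0 1 := by
  have ht := neg_one_lt_node h₁ h₂ 0
  rw [Q, mul_sum, zero_add, sum_range_one, xi_one, mul_one,
    type_I_coeff h₀ h₁ h₂ h₁₂ (by simp)]
  simp only [zero_add, range_one, erase_singleton, prod_empty, range_zero, Nat.cast_zero, add_zero,
    one_mul, div_one]
  have n1 := Real.Gamma_pos_of_pos (by linarith : 0 < α₀ + 1)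
  have n2 := Real.Gamma_pos_of_pos (by linarith : 0 < node α₁ α₂ 0 + 1)
  have n3 := Real.Gamma_pos_of_pos (by linarith : 0 < node α₁ α₂ 0 + (α₀ + 1) + 1)
  positivity

end

/-! ### Asymptotics of the recurrence coefficients -/

section

variable {t : ℕ → ℝ}

/-- Adding `1` to `s` shifts the nodes by two indices, so the two products overlap up to a bounded
number of factors. -/
theorem prod_add_node_succ (hshift : ∀ j, t (j + 2) = t j + 1) (s : ℝ) (n : ℕ) :
    (∏ j ∈ range (n + 1), (s + 1 + t j)) * ((s + t 0) * (s + t 1))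
      = (∏ j ∈ range n, (s + t j)) * ((s + t n) * (s + t (n + 1)) * (s + t (n + 2))) := by
  have h : ∏ j ∈ range (n + 3), (s + t j)
      = (∏ j ∈ range (n + 1), (s + t (j + 2))) * (s + t 1) * (s + t 0) := by
    rw [prod_range_succ', prod_range_succ']
  rw [prod_range_succ, prod_range_succ, prod_range_succ] at h
  simp only [hshift, add_left_comm s, add_comm (t _) 1, ← add_assoc] at h ⊢
  simp only [add_comm 1 s] at h ⊢
  linarith

theorem typeIIAtOne_succ_div {β : ℝ} (hβ : 0 < β) (ht : ∀ j, -1 < t j)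
    (hshift : ∀ j, t (j + 2) = t j + 1) {n : ℕ} (hn : n ≠ 0) :
    typeIIAtOne β t (n + 1) / typeIIAtOne β t n
      = (β + n) * (β + n + t 0) * (β + n + t 1)
        / ((β + n + t n) * (β + n + t (n + 1)) * (β + n + t (n + 2))) := by
  have hn1 : (1 : ℝ) ≤ n := by exact_mod_cast Nat.one_le_iff_ne_zero.2 hn
  have hp : ∀ j, β + n + t j ≠ 0 := fun j => by have := ht j; linarith
  have h := prod_add_node_succ hshift (β + n) n
  have hP := (pochhammer_pos hβ n).ne'
  have hN := (prod_add_node_pos hβ ht (n := n) range_nonempty_imp).ne'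
  have hN' := (prod_add_node_pos hβ ht (n := n + 1) range_nonempty_imp).ne'
  rw [typeIIAtOne, typeIIAtOne, prod_range_succ (fun l : ℕ => β + (l : ℝ))]
  push_cast at hN' ⊢
  simp only [← add_assoc] at hN' ⊢
  have h0 := hp 0
  have h1 := hp 1
  have h2 := hp n
  have h3 := hp (n + 1)
  have h4 := hp (n + 2)
  generalize ∏ j ∈ range (n + 1), (β + n + 1 + t j) = M at *
  generalize ∏ j ∈ range n, (β + n + t j) = N at *
  field_simp
  linear_combination (-1 : ℝ) * h

theorem tendsto_const_add_natCast_div (c : ℝ) :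
    Tendsto (fun n : ℕ => (c + n) / n) atTop (𝓝 1) := by
  have h := (tendsto_const_div_atTop_nhds_zero_nat c).add_const 1
  rw [zero_add] at h
  refine h.congr' ?_
  filter_upwards [eventually_ne_atTop 0] with n hn
  have : (n : ℝ) ≠ 0 := by exact_mod_cast hn
  field_simp

theorem tendsto_node_add_div (hlim : Tendsto (fun n : ℕ => t n / n) atTop (𝓝 (1 / 2))) (k : ℕ) :
    Tendsto (fun n : ℕ => t (n + k) / n) atTop (𝓝 (1 / 2)) := by
  have h1 := ((tendsto_add_atTop_iff_nat k).2 hlim).mul (tendsto_const_add_natCast_div k)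
  rw [mul_one] at h1
  refine h1.congr fun n => ?_
  rcases Nat.eq_zero_or_pos (n + k) with h | h
  · obtain ⟨rfl, rfl⟩ : n = 0 ∧ k = 0 := by omega
    simp
  · have : ((n + k : ℕ) : ℝ) ≠ 0 := by exact_mod_cast h.ne'
    have h2 : (k : ℝ) + n = ((n + k : ℕ) : ℝ) := by push_cast; ring
    rw [h2]
    field_simp

theorem tendsto_const_add_node_div (hlim : Tendsto (fun n : ℕ => t n / n) atTop (𝓝 (1 / 2)))
    (c : ℝ) (k : ℕ) :
    Tendsto (fun n : ℕ => (c + n + t (n + k)) / n) atTop (𝓝 (3 / 2)) := by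
  have h := (tendsto_const_add_natCast_div c).add (tendsto_node_add_div hlim k)
  norm_num at h
  exact h.congr fun n => by ring

theorem tendsto_typeIIAtOne_succ_div {β : ℝ} (hβ : 0 < β) (ht : ∀ j, -1 < t j)
    (hshift : ∀ j, t (j + 2) = t j + 1)
    (hlim : Tendsto (fun n : ℕ => t n / n) atTop (𝓝 (1 / 2))) :
    Tendsto (fun n : ℕ => typeIIAtOne β t (n + 1) / typeIIAtOne β t n) atTop (𝓝 (8 / 27)) := by
  have hc : ∀ j, Tendsto (fun n : ℕ => (β + n + t j) / n) atTop (𝓝 1) := fun j =>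
    (tendsto_const_add_natCast_div (β + t j)).congr fun n => by ring
  have h := (((tendsto_const_add_natCast_div β).mul (hc 0)).mul (hc 1)).div
    (((tendsto_const_add_node_div hlim β 0).mul (tendsto_const_add_node_div hlim β 1)).mul
      (tendsto_const_add_node_div hlim β 2)) (by norm_num)
  norm_num at h
  refine h.congr' ?_
  filter_upwards [eventually_ne_atTop 0] with n hn
  rw [typeIIAtOne_succ_div hβ ht hshift hn]
  have : (n : ℝ) ≠ 0 := by exact_mod_cast hn
  simp only [Pi.div_apply]
  field_simp

theorem tendsto_add_two_div {p : ℕ → ℝ} {r : ℝ} (hp : ∀ n, p n ≠ 0)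
    (h : Tendsto (fun n => p (n + 1) / p n) atTop (𝓝 r)) :
    Tendsto (fun n => p (n + 2) / p n) atTop (𝓝 (r * r)) :=
  (((tendsto_add_atTop_iff_nat 1).2 h).mul h).congr fun n => div_mul_div_cancel₀ (hp (n + 1))

theorem prod_node_sub_add_two (hshift : ∀ j, t (j + 2) = t j + 1) (n : ℕ) :
    ∏ j ∈ range (n + 2), (t (n + 2) - t j)
      = (∏ j ∈ range n, (t n - t j)) * ((t (n + 2) - t 1) * (t (n + 2) - t 0)) := by
  rw [prod_range_succ', prod_range_succ', mul_assoc]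
  congr 1
  exact prod_congr rfl fun j _ => by rw [hshift, hshift]; ring

/-- If two solutions of a four-term recurrence with growth rates `u ≠ v` are known and one of the
coefficients converges, then so do the other two. -/
theorem tendsto_recurrence_coeff {p q A C D : ℕ → ℝ} {x y u v d : ℝ} (hp0 : ∀ n, p n ≠ 0)
    (hq0 : ∀ n, q n ≠ 0) (hu : u ≠ 0) (hv : v ≠ 0) (huv : u ≠ v)
    (hp : Tendsto (fun n => p (n + 1) / p n) atTop (𝓝 u))
    (hq : Tendsto (fun n => q (n + 1) / q n) atTop (𝓝 v)) (hD : Tendsto D atTop (𝓝 d))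
    (hrp : ∀ n, p (n + 3) + A n * p (n + 2) + C n * p (n + 1) + D n * p n = x * p (n + 2))
    (hrq : ∀ n, q (n + 3) + A n * q (n + 2) + C n * q (n + 1) + D n * q n = y * q (n + 2)) :
    (∃ a, Tendsto A atTop (𝓝 a)) ∧ ∃ c, Tendsto C atTop (𝓝 c) := by
  -- Dividing the recurrence by `p (n + 1)` makes everything but `A` and `C` convergent. Subtracting
  -- the resulting relations for `p` and `q` then isolates `A`.
  have key : ∀ {p : ℕ → ℝ} {x u : ℝ}, (∀ n, p n ≠ 0) → u ≠ 0 →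
      Tendsto (fun n => p (n + 1) / p n) atTop (𝓝 u) →
      (∀ n, p (n + 3) + A n * p (n + 2) + C n * p (n + 1) + D n * p n = x * p (n + 2)) →
      ∃ e, Tendsto (fun n => A n * (p (n + 2) / p (n + 1)) + C n) atTop (𝓝 e) := by
    intro p x u hp0 hu hp hr
    have h1 := (tendsto_add_atTop_iff_nat 1).2 hp
    have h2 := (tendsto_add_atTop_iff_nat 1).2 (tendsto_add_two_div hp0 hp)
    refine ⟨_, (((h1.const_mul x).sub h2).sub (hD.div hp hu)).congr fun n => ?_⟩
    have := hr n
    have n0 := hp0 n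
    have n1 := hp0 (n + 1)
    simp only [Pi.div_apply, add_assoc, Nat.reduceAdd] at *
    field_simp
    linarith
  obtain ⟨e, he⟩ := key hp0 hu hp hrp
  obtain ⟨f, hf⟩ := key hq0 hv hq hrq
  have hp1 := (tendsto_add_atTop_iff_nat 1).2 hp
  have hq1 := (tendsto_add_atTop_iff_nat 1).2 hq
  have hd := hp1.sub hq1
  have hne := sub_ne_zero.2 huv
  have hA : Tendsto A atTop (𝓝 ((e - f) / (u - v))) := by
    refine ((he.sub hf).div hd hne).congr' ?_
    filter_upwards [hd.eventually_ne hne] with n hn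
    simp only [add_assoc, Nat.reduceAdd, Pi.div_apply] at *
    rw [div_eq_iff hn]
    ring
  refine ⟨⟨_, hA⟩, _, (he.sub (hA.mul hp1)).congr fun n => ?_⟩
  simp only [add_assoc, Nat.reduceAdd]
  ring

end

/-! ### Limits of the Jacobi–Piñeiro recurrence coefficients -/

section

variable {α₀ α₁ α₂ : ℝ}

theorem factors_H_add_two_div (h₀ : -1 < α₀) (h₁ : -1 < α₁) (h₂ : -1 < α₂)
    (h₁₂ : ∀ m : ℤ, α₁ - α₂ ≠ m) (n : ℕ) :
    (factors α₀ α₁ α₂).H (n + 2) / (factors α₀ α₁ α₂).H n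
      = (1 + node α₁ α₂ n) * ((node α₁ α₂ (n + 2) - node α₁ α₂ 1)
          * (node α₁ α₂ (n + 2) - node α₁ α₂ 0))
        / ((α₀ + 2 + n + node α₁ α₂ n) * (α₀ + 3 + n + node α₁ α₂ n)
          * (α₀ + 4 + n + node α₁ α₂ n))
        * (typeIIAtOne (α₀ + 1) (node α₁ α₂) (n + 2) / typeIIAtOne (α₀ + 1) (node α₁ α₂) n) := by
  have hβ : 0 < α₀ + 1 := by linarith
  have ht := neg_one_lt_node h₁ h₂
  have hshift := node_add_two α₁ α₂
  have hinj := node_injective h₁₂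
  rw [factors_H h₀ h₁ h₂ h₁₂, factors_H h₀ h₁ h₂ h₁₂, prod_node_sub_add_two hshift]
  set t := node α₁ α₂
  have hb := (typeIIAtOne_pos hβ ht n).ne'
  have hb2 := (typeIIAtOne_pos hβ ht (n + 2)).ne'
  have hn : (0 : ℝ) ≤ n := n.cast_nonneg
  have htn := ht n
  have hD : ∏ j ∈ range n, (t n - t j) ≠ 0 := prod_ne_zero_iff.2 fun j hj =>
    sub_ne_zero.2 fun h => (mem_range.1 hj).ne' (hinj h)
  have g0 := (Real.Gamma_pos_of_pos hβ).ne'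
  have g1 := (Real.Gamma_pos_of_pos (by linarith : 0 < t n + 1)).ne'
  have g2 := (Real.Gamma_pos_of_pos (by linarith : 0 < t n + (α₀ + 1) + 1 + n)).ne'
  have e1 : Real.Gamma (t (n + 2) + 1) = (1 + t n) * Real.Gamma (t n + 1) := by
    rw [hshift, Real.Gamma_add_one (by linarith), add_comm 1]
  have e2 : Real.Gamma (t (n + 2) + (α₀ + 1) + 1 + (n + 2 : ℕ))
      = (α₀ + 2 + n + t n) * (α₀ + 3 + n + t n) * (α₀ + 4 + n + t n)
        * Real.Gamma (t n + (α₀ + 1) + 1 + n) := by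
    have : t (n + 2) + (α₀ + 1) + 1 + ((n + 2 : ℕ) : ℝ)
        = t n + (α₀ + 1) + 1 + n + 1 + 1 + 1 := by rw [hshift]; push_cast; ring
    rw [this, Real.Gamma_add_one (by linarith), Real.Gamma_add_one (by linarith),
      Real.Gamma_add_one (by linarith)]
    ring
  have p2 : α₀ + 2 + n + t n ≠ 0 := by linarith
  have p3 : α₀ + 3 + n + t n ≠ 0 := by linarith
  have p4 : α₀ + 4 + n + t n ≠ 0 := by linarith
  rw [e1, e2]
  generalize ∏ j ∈ range n, (t n - t j) = P at hD ⊢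
  generalize t (n + 2) - t 1 = A
  generalize t (n + 2) - t 0 = A'
  field_simp

theorem tendsto_factors_H_add_two_div (h₀ : -1 < α₀) (h₁ : -1 < α₁) (h₂ : -1 < α₂)
    (h₁₂ : ∀ m : ℤ, α₁ - α₂ ≠ m) :
    Tendsto (fun n => (factors α₀ α₁ α₂).H (n + 2) / (factors α₀ α₁ α₂).H n) atTop
      (𝓝 ((4 / 27) ^ 3)) := by
  have hβ : 0 < α₀ + 1 := by linarith
  have ht := neg_one_lt_node h₁ h₂
  have hshift := node_add_two α₁ α₂
  have hlim := tendsto_node_div α₁ α₂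
  have hc : ∀ c : ℝ, ∀ k : ℕ,
      Tendsto (fun n : ℕ => (c + node α₁ α₂ (n + k)) / n) atTop (𝓝 (1 / 2)) := fun c k => by
    have h := (tendsto_const_div_atTop_nhds_zero_nat c).add (tendsto_node_add_div hlim k)
    rw [zero_add] at h
    exact h.congr fun n => by ring
  have hd := fun c => tendsto_const_add_node_div hlim c 0
  have h := (((hc 1 0).mul ((hc (-node α₁ α₂ 1) 2).mul (hc (-node α₁ α₂ 0) 2))).div
    (((hd (α₀ + 2)).mul (hd (α₀ + 3))).mul (hd (α₀ + 4))) (by norm_num)).mul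
    (tendsto_add_two_div (fun n => (typeIIAtOne_pos hβ ht n).ne')
      (tendsto_typeIIAtOne_succ_div hβ ht hshift hlim))
  norm_num at h ⊢
  refine h.congr' ?_
  filter_upwards [eventually_ne_atTop 0] with n hn
  rw [factors_H_add_two_div h₀ h₁ h₂ h₁₂]
  have : (n : ℝ) ≠ 0 := by exact_mod_cast hn
  simp only [neg_add_eq_sub]
  congr 1
  field_simp

theorem tendsto_B_one_succ_div (h₀ : -1 < α₀) (h₁ : -1 < α₁) (h₂ : -1 < α₂)
    (h₁₂ : ∀ m : ℤ, α₁ - α₂ ≠ m) :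
    Tendsto (fun n => B α₀ α₁ α₂ (n + 1) 1 / B α₀ α₁ α₂ n 1) atTop (𝓝 (8 / 27)) := by
  simp only [B_one h₀ h₁ h₂ h₁₂]
  exact tendsto_typeIIAtOne_succ_div (by linarith) (neg_one_lt_node h₁ h₂) (node_add_two α₁ α₂)
    (tendsto_node_div α₁ α₂)

theorem B_zero_ne_zero (h₀ : -1 < α₀) (h₁ : -1 < α₁) (h₂ : -1 < α₂)
    (h₁₂ : ∀ m : ℤ, α₁ - α₂ ≠ m) (n : ℕ) : B α₀ α₁ α₂ n 0 ≠ 0 := by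
  have hβ : 0 < α₀ + 1 := by linarith
  have ht := neg_one_lt_node h₁ h₂
  rw [B_zero h₀ h₁ h₂ h₁₂]
  refine div_ne_zero (mul_ne_zero (typeIIAtOne_pos hβ ht n).ne' (mul_ne_zero (by simp)
    (prod_ne_zero_iff.2 fun j _ => ?_))) (pochhammer_pos hβ n).ne'
  have := ht j
  linarith

theorem tendsto_B_zero_succ_div (h₀ : -1 < α₀) (h₁ : -1 < α₁) (h₂ : -1 < α₂)
    (h₁₂ : ∀ m : ℤ, α₁ - α₂ ≠ m) :
    Tendsto (fun n => B α₀ α₁ α₂ (n + 1) 0 / B α₀ α₁ α₂ n 0) atTop (𝓝 (-4 / 27)) := by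
  have hβ : 0 < α₀ + 1 := by linarith
  have ht := neg_one_lt_node h₁ h₂
  have h3 : Tendsto (fun n : ℕ => (1 + node α₁ α₂ n) / n) atTop (𝓝 (1 / 2)) := by
    have h := (tendsto_const_div_atTop_nhds_zero_nat 1).add (tendsto_node_div α₁ α₂)
    rw [zero_add] at h
    exact h.congr fun n => by ring
  have h4 := ((tendsto_typeIIAtOne_succ_div hβ ht (node_add_two α₁ α₂)
    (tendsto_node_div α₁ α₂)).mul
    (h3.div (tendsto_const_add_natCast_div (α₀ + 1)) one_ne_zero)).neg
  rw [show -(8 / 27 * (1 / 2 / 1)) = (-4 / 27 : ℝ) by norm_num] at h4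
  refine h4.congr' ?_
  filter_upwards [eventually_ne_atTop 0] with n hn
  have hn' : (n : ℝ) ≠ 0 := by exact_mod_cast hn
  rw [B_zero h₀ h₁ h₂ h₁₂, B_zero h₀ h₁ h₂ h₁₂, prod_range_succ, prod_range_succ, pow_succ]
  have n1 := (typeIIAtOne_pos hβ ht n).ne'
  have n2 := (pochhammer_pos hβ n).ne'
  have n3 : α₀ + 1 + (n : ℝ) ≠ 0 := by
    have := n.cast_nonneg (α := ℝ)
    linarith
  have n4 : ∏ j ∈ range n, (1 + node α₁ α₂ j) ≠ 0 := prod_ne_zero_iff.2 fun j _ => by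
    have := ht j
    linarith
  generalize ∏ j ∈ range n, (1 + node α₁ α₂ j) = P at n4 ⊢
  generalize ∏ j ∈ range n, (α₀ + 1 + (j : ℝ)) = R at n2 ⊢
  simp only [Pi.div_apply]
  field_simp

theorem exists_tendsto_hess (h₀ : -1 < α₀) (h₁ : -1 < α₁) (h₂ : -1 < α₂)
    (h₁₂ : ∀ m : ℤ, α₁ - α₂ ≠ m) (k : ℕ) (hk : k ≤ 2) :
    ∃ a, Tendsto (fun n => hess α₀ α₁ α₂ (n + k) n) atTop (𝓝 a) := by
  have hF := isGaussBorel_factors h₀ h₁ h₂ h₁₂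
  have hg := moment_succ α₀ α₁ α₂
  have hB1 : ∀ n, B α₀ α₁ α₂ n 1 ≠ 0 := fun n => by
    rw [B_one h₀ h₁ h₂ h₁₂]
    exact (typeIIAtOne_pos (by linarith) (neg_one_lt_node h₁ h₂) n).ne'
  have hD := tendsto_factors_H_add_two_div h₀ h₁ h₂ h₁₂
  obtain ⟨⟨a, ha⟩, c, hc⟩ := tendsto_recurrence_coeff hB1 (B_zero_ne_zero h₀ h₁ h₂ h₁₂)
    (by norm_num) (by norm_num) (by norm_num) (tendsto_B_one_succ_div h₀ h₁ h₂ h₁₂)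
    (tendsto_B_zero_succ_div h₀ h₁ h₂ h₁₂) hD
    (fun n => hF.recurrence hg n 1 (p := fun n => B α₀ α₁ α₂ n 1) fun _ => rfl)
    (fun n => hF.recurrence hg n 0 (p := fun n => B α₀ α₁ α₂ n 0) fun _ => rfl)
  interval_cases k
  · exact ⟨a, (tendsto_add_atTop_iff_nat 2).1 ha⟩
  · exact ⟨c, (tendsto_add_atTop_iff_nat 1).1 hc⟩
  · exact ⟨_, hD.congr fun n => (hF.hessOf_add_two hg n).symm⟩

end

/-! ### A series for quotients of Gamma functions -/

theorem choose_eq_prod_div (a : ℝ) (n : ℕ) :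
    Ring.choose (a + n - 1) n = (∏ l ∈ range n, (a + l)) / n.factorial := by
  have h := Ring.factorial_nsmul_multichoose_eq_ascPochhammer a n
  rw [ascPochhammer_smeval_eq_eval, nsmul_eq_mul, Ring.multichoose_eq] at h
  have h2 : (ascPochhammer ℝ n).eval a = ∏ l ∈ range n, (a + l) := by
    induction n with
    | zero => simp
    | succ n ih =>
      rw [ascPochhammer_succ_eval, prod_range_succ, ih]
      have := Ring.factorial_nsmul_multichoose_eq_ascPochhammer a n
      rwa [ascPochhammer_smeval_eq_eval, nsmul_eq_mul, Ring.multichoose_eq] at this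
  rw [eq_div_iff (by exact_mod_cast n.factorial_ne_zero), mul_comm, h, h2]

theorem hasSum_one_sub_rpow (a : ℝ) {u : ℝ} (hu : |u| < 1) :
    HasSum (fun k : ℕ => (∏ l ∈ range k, (a + l)) / k.factorial * u ^ k) ((1 - u) ^ (-a)) := by
  have hu' : ‖u‖₊ < 1 := by
    rw [← NNReal.coe_lt_coe]
    simpa using hu
  have h := (Real.one_div_one_sub_rpow_hasFPowerSeriesOnBall_zero a).hasSum
    (y := u) (by simpa [enorm_eq_nnnorm] using hu')
  have hpos : 0 ≤ 1 - u := by linarith [(abs_lt.1 hu).2]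
  simp only [zero_add, FormalMultilinearSeries.ofScalars_apply_eq, choose_eq_prod_div,
    smul_eq_mul] at h
  rwa [one_div, ← Real.rpow_neg hpos] at h

/-- The factor `(1 - x) ^ (-β)` of a Beta integrand is expanded in its binomial series. The
coefficients are nonnegative for `β > 0`, so monotone convergence allows termwise integration; `β <
1` makes the integral finite. -/
theorem hasSum_beta {β y : ℝ} (hβ : 0 < β) (hβ1 : β < 1) (hy : 0 < y) :
    HasSum (fun k : ℕ => (∏ l ∈ range k, (β + l)) / k.factorial / (y + k))
      (Real.Gamma y * Real.Gamma (1 - β) / Real.Gamma (y + 1 - β)) := by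
  set b : ℕ → ℝ := fun k => (∏ l ∈ range k, (β + l)) / k.factorial with hb
  have hb0 : ∀ k, 0 ≤ b k := fun k =>
    div_nonneg (pochhammer_pos hβ k).le (Nat.cast_nonneg _)
  have hint := integral_rpow_mul_one_sub_rpow hy (by linarith : 0 < 1 - β)
  have hpos : 0 < Real.Gamma y * Real.Gamma (1 - β) / Real.Gamma (y + 1 - β) :=
    div_pos (mul_pos (Real.Gamma_pos_of_pos hy) (Real.Gamma_pos_of_pos (by linarith)))
      (Real.Gamma_pos_of_pos (by linarith))
  rw [← add_sub_assoc] at hint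
  -- The integral of a non-integrable function is `0` by convention, so a positive value proves
  -- integrability.
  have hI : IntervalIntegrable (fun x : ℝ => x ^ (y - 1) * (1 - x) ^ (1 - β - 1))
      MeasureTheory.volume 0 1 :=
    intervalIntegral.intervalIntegrable_of_integral_ne_zero (by rw [hint]; exact hpos.ne')
  have hpow : ∀ k : ℕ, IntervalIntegrable (fun x : ℝ => b k * x ^ (y + k - 1))
      MeasureTheory.volume 0 1 := fun k =>
    (intervalIntegral.intervalIntegrable_rpow'
      (by linarith [k.cast_nonneg (α := ℝ)])).const_mul _
  have hterm : ∀ k : ℕ, ∫ x in (0 : ℝ)..1, b k * x ^ (y + k - 1) = b k / (y + k) := fun k => by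
    have hk := k.cast_nonneg (α := ℝ)
    rw [intervalIntegral.integral_const_mul, integral_rpow (Or.inl (by linarith)),
      sub_add_cancel, Real.one_rpow, Real.zero_rpow (by linarith), sub_zero, mul_one_div]
  rw [hasSum_iff_tendsto_nat_of_nonneg (fun k => div_nonneg (hb0 k) (by positivity)), ← hint]
  have hsum : ∀ N : ℕ, ∑ k ∈ range N, b k / (y + k)
      = ∫ x in Set.Ioc (0 : ℝ) 1, ∑ k ∈ range N, b k * x ^ (y + k - 1) := fun N => by
    rw [← intervalIntegral.integral_of_le zero_le_one,
      intervalIntegral.integral_finsetSum fun k _ => hpow k]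
    exact sum_congr rfl fun k _ => (hterm k).symm
  simp only [hsum]
  rw [intervalIntegral.integral_of_le zero_le_one]
  have hIoo : ∀ᵐ x ∂(MeasureTheory.volume.restrict (Set.Ioc (0 : ℝ) 1)), x ∈ Set.Ioo (0 : ℝ) 1 := by
    rw [← MeasureTheory.restrict_Ioo_eq_restrict_Ioc]
    exact MeasureTheory.ae_restrict_mem measurableSet_Ioo
  refine MeasureTheory.integral_tendsto_of_tendsto_of_monotone (fun N => ?_) ?_ ?_ ?_
  · exact MeasureTheory.integrable_finsetSum _ fun k _ =>
      (intervalIntegrable_iff_integrableOn_Ioc_of_le zero_le_one).1 (hpow k)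
  · exact (intervalIntegrable_iff_integrableOn_Ioc_of_le zero_le_one).1 hI
  · filter_upwards [hIoo] with x hx
    refine monotone_nat_of_le_succ fun N => ?_
    rw [sum_range_succ]
    exact le_add_of_nonneg_right (mul_nonneg (hb0 N) (Real.rpow_nonneg hx.1.le _))
  · filter_upwards [hIoo] with x hx
    have h := ((hasSum_one_sub_rpow β (abs_lt.2 ⟨by linarith [hx.1], hx.2⟩)).mul_left
      (x ^ (y - 1))).tendsto_sum_nat
    rw [show 1 - β - 1 = -β by ring]
    refine h.congr fun N => sum_congr rfl fun k _ => ?_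
    rw [show y + (k : ℝ) - 1 = y - 1 + k by ring, Real.rpow_add hx.1, Real.rpow_natCast]
    ring

/-! ### Divided differences -/

section

variable {t : ℕ → ℝ}

theorem dividedDiff_congr {f g : ℝ → ℝ} {n : ℕ} (h : ∀ j ≤ n, f (t j) = g (t j)) :
    dividedDiff t f n = dividedDiff t g n :=
  sum_congr rfl fun j hj => by rw [h j (Nat.lt_succ_iff.1 (mem_range.1 hj))]

theorem dividedDiff_add (f g : ℝ → ℝ) (n : ℕ) :
    dividedDiff t (fun x => f x + g x) n = dividedDiff t f n + dividedDiff t g n := by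
  simp only [dividedDiff, add_div, sum_add_distrib]

theorem dividedDiff_const_mul (c : ℝ) (f : ℝ → ℝ) (n : ℕ) :
    dividedDiff t (fun x => c * f x) n = c * dividedDiff t f n := by
  simp only [dividedDiff, mul_sum, mul_div_assoc]

theorem hasSum_dividedDiff {ι : Type*} {f : ι → ℝ → ℝ} {g : ℝ → ℝ} {n : ℕ}
    (h : ∀ j ≤ n, HasSum (fun i => f i (t j)) (g (t j))) :
    HasSum (fun i => dividedDiff t (f i) n) (dividedDiff t g n) :=
  hasSum_sum fun j hj => (h j (Nat.lt_succ_iff.1 (mem_range.1 hj))).div_const _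

/-- Write `x + c = (t (n+1) + c) + (x - t (n+1))`: the second summand cancels the last node. -/
theorem dividedDiff_succ_mul (hinj : Function.Injective t) (f : ℝ → ℝ) (c : ℝ) (n : ℕ) :
    dividedDiff t (fun x => (x + c) * f x) (n + 1)
      = (t (n + 1) + c) * dividedDiff t f (n + 1) + dividedDiff t f n := by
  rw [dividedDiff, dividedDiff, mul_sum, sum_range_succ, sum_range_succ _ (n + 1),
    add_right_comm (Finset.sum _ _),
    dividedDiff, ← sum_add_distrib, mul_div_assoc]
  congr 1
  refine sum_congr rfl fun j hj => ?_
  have hj' := mem_range.1 hj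
  have h1 : (range (n + 1 + 1)).erase j = insert (n + 1) ((range (n + 1)).erase j) := by
    rw [range_add_one, erase_insert_of_ne (by omega)]
  have h2 : ∏ k ∈ (range (n + 1)).erase j, (t j - t k) ≠ 0 := prod_ne_zero_iff.2 fun k hk =>
    sub_ne_zero.2 fun h => (ne_of_mem_erase hk) (hinj h).symm
  have h3 : t j - t (n + 1) ≠ 0 := sub_ne_zero.2 fun h => hj'.ne (hinj h)
  rw [h1, prod_insert (by simp)]
  field_simp
  ring

theorem dividedDiff_eval (hinj : Function.Injective t) {P : ℝ[X]} {n : ℕ}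
    (hP : P.natDegree ≤ n) : dividedDiff t (fun x => P.eval x) n = P.coeff n := by
  have h := Lagrange.coeff_eq_sum (s := range (n + 1)) (v := t) hinj.injOn (P := P)
    (by
      rw [card_range]
      exact (degree_le_of_natDegree_le hP).trans_lt (by exact_mod_cast Nat.lt_succ_self n))
  rw [card_range, Nat.add_sub_cancel] at h
  exact h.symm

theorem dividedDiff_inv (hinj : Function.Injective t) {a : ℝ} {n : ℕ}
    (ha : ∀ j ≤ n, t j + a ≠ 0) :
    dividedDiff t (fun x => 1 / (x + a)) n = (-1) ^ n / ∏ j ∈ range (n + 1), (t j + a) := by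
  induction n with
  | zero => simp [dividedDiff]
  | succ n ih =>
    have h1 := dividedDiff_succ_mul hinj (fun x => 1 / (x + a)) a n
    have h2 : dividedDiff t (fun x => (x + a) * (1 / (x + a))) (n + 1)
        = dividedDiff t (fun x => (1 : ℝ[X]).eval x) (n + 1) :=
      dividedDiff_congr fun j hj => by rw [mul_one_div_cancel (ha j hj), eval_one]
    rw [h2, dividedDiff_eval hinj (by simp), coeff_one, if_neg (by omega),
      ih fun j hj => ha j (by omega)] at h1
    have h3 := ha (n + 1) le_rfl
    have h4 : ∏ j ∈ range (n + 1), (t j + a) ≠ 0 := prod_ne_zero_iff.2 fun j hj =>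
      ha j (by have := mem_range.1 hj; omega)
    rw [prod_range_succ _ (n + 1), eq_div_iff (mul_ne_zero h4 h3), pow_succ]
    field_simp at h1
    linarith

/-- Division by `x + a` leaves the remainder `P(-a)` and a quotient with vanishing coefficient at
degree `n`, which the divided difference does not see. -/
theorem dividedDiff_eval_div (hinj : Function.Injective t) {P : ℝ[X]} {n : ℕ} {a : ℝ}
    (hP : P.natDegree ≤ n) (ha : ∀ j ≤ n, t j + a ≠ 0) :
    dividedDiff t (fun x => P.eval x / (x + a)) n
      = P.eval (-a) * ((-1) ^ n / ∏ j ∈ range (n + 1), (t j + a)) := by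
  obtain ⟨q, hq⟩ := X_sub_C_dvd_sub_C_eval (a := -a) (p := P)
  have hq0 : q.coeff n = 0 := by
    by_cases h0 : q = 0
    · simp [h0]
    · have h1 : (P - C (P.eval (-a))).natDegree ≤ n :=
        (natDegree_sub_le _ _).trans (max_le hP (by simp))
      rw [hq, natDegree_mul (X_sub_C_ne_zero _) h0, natDegree_X_sub_C] at h1
      exact coeff_eq_zero_of_natDegree_lt (by omega)
  have hqd : q.natDegree ≤ n := by
    by_cases h0 : q = 0
    · simp [h0]
    · have h1 : (P - C (P.eval (-a))).natDegree ≤ n :=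
        (natDegree_sub_le _ _).trans (max_le hP (by simp))
      rw [hq, natDegree_mul (X_sub_C_ne_zero _) h0, natDegree_X_sub_C] at h1
      omega
  have h2 : dividedDiff t (fun x => P.eval x / (x + a)) n
      = dividedDiff t (fun x => q.eval x + P.eval (-a) * (1 / (x + a))) n :=
    dividedDiff_congr fun j hj => by
      have h3 := congrArg (eval (t j)) hq
      simp only [eval_sub, eval_C, eval_mul, eval_X] at h3
      have h4 := ha j hj
      field_simp
      linarith
  rw [h2, dividedDiff_add, dividedDiff_const_mul, dividedDiff_eval hinj hqd, hq0, zero_add,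
    dividedDiff_inv hinj ha]

end

/-! ### Divided differences of quotients of Gamma functions -/

/-- The divided difference of `Γ(x + β + n) / Γ(x + 1)` at `t 0, …, t n`. -/
noncomputable def gammaDiff (t : ℕ → ℝ) (β : ℝ) (n : ℕ) : ℝ :=
  dividedDiff t (fun x => Real.Gamma (x + (β + n)) / Real.Gamma (x + 1)) n

/-- The terms of a series for `gammaDiff`, up to a constant factor. -/
noncomputable def gammaWeight (t : ℕ → ℝ) (β : ℝ) (n i : ℕ) : ℝ :=
  (∏ l ∈ range (n + i), (β + l)) / (i.factorial * ∏ j ∈ range (n + 1), (t j + (β + n + i)))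

section

variable {t : ℕ → ℝ} {β : ℝ}

theorem gammaDiff_add_one_succ (hβ : 0 < β) (ht : ∀ j, -1 < t j) (hinj : Function.Injective t)
    (n : ℕ) : gammaDiff t (β + 1) (n + 1)
      = (t (n + 1) + (β + (n + 1 : ℕ))) * gammaDiff t β (n + 1) + gammaDiff t (β + 1) n := by
  have h := dividedDiff_succ_mul hinj
    (fun x => Real.Gamma (x + (β + (n + 1 : ℕ))) / Real.Gamma (x + 1)) (β + (n + 1 : ℕ)) n
  have h1 : dividedDiff t (fun x => (x + (β + (n + 1 : ℕ)))
      * (Real.Gamma (x + (β + (n + 1 : ℕ))) / Real.Gamma (x + 1))) (n + 1)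
      = gammaDiff t (β + 1) (n + 1) := dividedDiff_congr fun j _ => by
    have : 0 < t j + (β + (n + 1 : ℕ)) := by
      push_cast
      linarith [ht j, n.cast_nonneg (α := ℝ)]
    rw [← mul_div_assoc, ← Real.Gamma_add_one this.ne']
    ring_nf
  rw [h1] at h
  rw [h, gammaDiff, gammaDiff, show β + 1 + (n : ℝ) = β + (n + 1 : ℕ) by push_cast; ring]

theorem gammaDiff_one (ht : ∀ j, -1 < t j) (hinj : Function.Injective t) (n : ℕ) :
    gammaDiff t 1 n = 1 := by
  set P : ℝ[X] := ∏ l ∈ range n, (X + C (1 + (l : ℝ)))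
  have hPm : P.Monic := monic_prod_of_monic _ _ fun _ _ => monic_X_add_C _
  have hPd : P.natDegree = n := by
    rw [natDegree_prod_of_monic _ _ fun _ _ => monic_X_add_C _]
    simp only [natDegree_X_add_C, sum_const, card_range, smul_eq_mul, mul_one]
  have h : gammaDiff t 1 n = dividedDiff t (fun x => P.eval x) n := dividedDiff_congr fun j _ => by
    have hj : 0 < t j + 1 := by linarith [ht j]
    rw [← add_assoc, Gamma_add_natCast hj, mul_div_cancel_right₀ _ (Real.Gamma_pos_of_pos hj).ne',
      eval_prod]
    exact prod_congr rfl fun l _ => by simp [add_assoc]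
  have hc := hPm.coeff_natDegree
  rw [hPd] at hc
  rw [h, dividedDiff_eval hinj hPd.le, hc]

theorem gammaWeight_pos (hβ : 0 < β) (ht : ∀ j, -1 < t j) {n : ℕ} (hn : n ≠ 0) (i : ℕ) :
    0 < gammaWeight t β n i := by
  refine div_pos (pochhammer_pos hβ _) (mul_pos (by positivity) (prod_pos fun j _ => ?_))
  have : (1 : ℝ) ≤ n := by exact_mod_cast Nat.one_le_iff_ne_zero.2 hn
  linarith [ht j, i.cast_nonneg (α := ℝ)]

theorem factorial_mul_prod_sub (i m : ℕ) :
    (i.factorial : ℝ) * ∏ l ∈ range m, ((i + m : ℕ) - (l : ℝ)) = (i + m).factorial := by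
  induction m with
  | zero => simp
  | succ m ih =>
    rw [prod_range_succ', ← mul_assoc, ← add_assoc, Nat.factorial_succ, Nat.cast_mul, ← ih]
    push_cast
    simp only [add_sub_add_right_eq_sub]
    ring

theorem hasSum_congr_eq {f g : ℕ → ℝ} {a b : ℝ} (h : HasSum f a) (hf : ∀ i, g i = f i)
    (ha : b = a) : HasSum g b := by
  rwa [ha, funext hf]

/-- With `m = n - 1`, `Γ(x+β+n)/Γ(x+1)` is the polynomial `P` below times `Γ(x+1+β)/Γ(x+2)`, and
`hasSum_beta` expands the latter in the fractions `1/(x+1+β+k)`. Divided differences turn each term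
into `P(-(1+β+k))` times a factor of sign `(-1) ^ n`. -/
theorem hasSum_gammaWeight (hβ : 0 < β) (hβ1 : β < 1) (ht : ∀ j, -1 < t j)
    (hinj : Function.Injective t) {n : ℕ} (hn : n ≠ 0) :
    HasSum (gammaWeight t β n) (Real.Gamma (1 - β) * gammaDiff t β n) := by
  obtain ⟨m, rfl⟩ := Nat.exists_eq_succ_of_ne_zero hn
  set P : ℝ[X] := (X + C 1) * ∏ l ∈ range m, (X + C (1 + β + (l : ℝ))) with hP
  have hPeval : ∀ x, P.eval x = (x + 1) * ∏ l ∈ range m, (x + (1 + β + (l : ℝ))) := fun x => by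
    simp [hP, eval_prod]
  have hPd : P.natDegree ≤ m + 1 := by
    rw [hP, (monic_X_add_C _).natDegree_mul (monic_prod_of_monic _ _ fun _ _ => monic_X_add_C _),
      natDegree_prod_of_monic _ _ fun _ _ => monic_X_add_C _]
    simp only [natDegree_X_add_C, sum_const, card_range, smul_eq_mul, mul_one]
    omega
  set b : ℕ → ℝ := fun k => (∏ l ∈ range k, (β + l)) / k.factorial with hb
  have h1 : HasSum
      (fun k => dividedDiff t (fun x => b k * (P.eval x / (x + (1 + β + (k : ℝ))))) (m + 1))
      (dividedDiff t (fun x => Real.Gamma (1 - β)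
        * (Real.Gamma (x + (β + (m + 1 : ℕ))) / Real.Gamma (x + 1))) (m + 1)) := by
    refine hasSum_dividedDiff fun j _ => ?_
    have hj := ht j
    have h := (hasSum_beta hβ hβ1 (by linarith : 0 < t j + 1 + β)).mul_left (P.eval (t j))
    have hg1 := (Real.Gamma_pos_of_pos (by linarith : 0 < t j + 1)).ne'
    have e1 : Real.Gamma (t j + (β + (m + 1 : ℕ)))
        = (∏ l ∈ range m, (t j + (1 + β + (l : ℝ)))) * Real.Gamma (t j + 1 + β) := by
      rw [show t j + (β + (m + 1 : ℕ)) = t j + 1 + β + m by push_cast; ring,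
        Gamma_add_natCast (by linarith)]
      congr 1
      exact prod_congr rfl fun _ _ => by ring
    have e2 : Real.Gamma (t j + 1 + β + 1 - β) = (t j + 1) * Real.Gamma (t j + 1) := by
      rw [← Real.Gamma_add_one (by linarith)]
      ring_nf
    rw [e2, hPeval] at h
    rw [e1, hPeval]
    have h3 : t j + 1 ≠ 0 := by linarith
    refine hasSum_congr_eq h (fun k => ?_) ?_
    · rw [show t j + 1 + β + (k : ℝ) = t j + (1 + β + (k : ℝ)) by ring]
      ring
    · generalize ∏ l ∈ range m, (t j + (1 + β + (l : ℝ))) = M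
      field_simp
  simp only [dividedDiff_const_mul] at h1
  have hne : ∀ k j : ℕ, j ≤ m + 1 → t j + (1 + β + (k : ℝ)) ≠ 0 := fun k j _ => by
    have := ht j
    have := k.cast_nonneg (α := ℝ)
    linarith
  -- The zeros of `P` remove the terms with `k < m`; the series restarts at `k = i + m`, where the
  -- two signs cancel and all terms are positive.
  rw [funext fun k => congrArg (b k * ·) (dividedDiff_eval_div hinj hPd (hne k)),
    ← hasSum_nat_add_iff' m, sum_eq_zero, sub_zero] at h1
  · change HasSum _ (Real.Gamma (1 - β) * dividedDiff t _ (m + 1))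
    refine hasSum_congr_eq h1 (fun i => ?_) rfl
    have f1 := factorial_mul_prod_sub i m
    have f2 : (i.factorial : ℝ) ≠ 0 := by exact_mod_cast i.factorial_ne_zero
    have f3 : ((i + m).factorial : ℝ) ≠ 0 := by exact_mod_cast (i + m).factorial_ne_zero
    have e3 : P.eval (-(1 + β + (i + m : ℕ)))
        = (-1) ^ (m + 1) * ((β + (i + m : ℕ)) * ∏ l ∈ range m, ((i + m : ℕ) - (l : ℝ))) := by
      rw [hPeval, pow_succ', mul_mul_mul_comm, ← card_range m, ← prod_const, card_range,
        mul_assoc (-1 : ℝ), mul_left_comm _ (β + _), ← mul_assoc, ← prod_mul_distrib]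
      congr 1
      · ring
      · exact prod_congr rfl fun l _ => by ring
    have e4 : ∏ j ∈ range (m + 1 + 1), (t j + (1 + β + ((i + m : ℕ) : ℝ)))
        = ∏ j ∈ range (m + 1 + 1), (t j + (β + (m + 1 : ℕ) + i)) :=
      prod_congr rfl fun j _ => by push_cast; ring
    have e5 : ∏ j ∈ range (m + 1 + 1), (t j + (β + (m + 1 : ℕ) + i)) ≠ 0 := by
      rw [← e4]
      exact prod_ne_zero_iff.2 fun j hj => hne _ j (Nat.lt_succ_iff.1 (mem_range.1 hj))
    simp only [hb, gammaWeight]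
    rw [e3, e4, show m.succ + i = i + m + 1 by omega, prod_range_succ, ← f1]
    have f4 : ∏ l ∈ range m, (((i + m : ℕ) : ℝ) - l) ≠ 0 := fun h => f3 (by rw [← f1, h, mul_zero])
    have f5 : ((-1 : ℝ) ^ (m + 1)) * (-1) ^ (m + 1) = 1 := by
      rw [← mul_pow]
      norm_num
    generalize ∏ l ∈ range m, (((i + m : ℕ) : ℝ) - l) = M at f4 ⊢
    generalize ((-1 : ℝ) ^ (m + 1)) = s at f5 ⊢
    simp only [Nat.succ_eq_add_one]
    generalize ∏ j ∈ range (m + 1 + 1), (t j + (β + (m + 1 : ℕ) + i)) = N at e5 ⊢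
    field_simp
    linear_combination (-1 : ℝ) * f5
  · intro k hk
    have : P.eval (-(1 + β + (k : ℝ))) = 0 := by
      rw [hPeval, prod_eq_zero hk (by ring), mul_zero]
    rw [this, zero_mul, mul_zero]

/-- This rewrites the series for `n + 1` in the weights for `n`, so that consecutive divided
differences become comparable. -/
theorem succ_mul_gammaWeight_succ (hβ : 0 < β) (ht : ∀ j, -1 < t j) (n i : ℕ) :
    (i + 1) * gammaWeight t β n (i + 1)
      = (t (n + 1) + (β + n + (i + 1 : ℕ))) * gammaWeight t β (n + 1) i := by
  have hpos : ∀ j, t j + (β + n + (i + 1 : ℕ)) ≠ 0 := fun j => by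
    have := ht j
    have := n.cast_nonneg (α := ℝ)
    have := i.cast_nonneg (α := ℝ)
    push_cast
    linarith
  have h1 : ∏ j ∈ range (n + 1), (t j + (β + n + (i + 1 : ℕ))) ≠ 0 :=
    prod_ne_zero_iff.2 fun j _ => hpos j
  have h2 := hpos (n + 1)
  have h3 : ∀ j, t j + (β + (n + 1 : ℕ) + i) = t j + (β + n + (i + 1 : ℕ)) := fun j => by
    push_cast; ring
  have h4 : (i.factorial : ℝ) ≠ 0 := by exact_mod_cast i.factorial_ne_zero
  have h5 : (i : ℝ) + 1 ≠ 0 := by positivity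
  simp only [gammaWeight, h3]
  rw [prod_range_succ _ (n + 1), Nat.factorial_succ, show n + (i + 1) = n + 1 + i by omega,
    Nat.cast_mul, show ((i + 1 : ℕ) : ℝ) = (i : ℝ) + 1 by push_cast; ring] at *
  field_simp

theorem one_sub_sum_le_prod_one_sub {ι : Type*} (s : Finset ι) {f : ι → ℝ}
    (h0 : ∀ i, 0 ≤ f i) (h1 : ∀ i, f i ≤ 1) : 1 - ∑ i ∈ s, f i ≤ ∏ i ∈ s, (1 - f i) := by
  classical
  induction s using Finset.induction_on with
  | empty => simp
  | insert a s ha ih =>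
    rw [sum_insert ha, prod_insert ha]
    have hp : ∏ i ∈ s, (1 - f i) ≤ 1 :=
      prod_le_one (fun i _ => sub_nonneg.2 (h1 i)) fun i _ => by linarith [h0 i]
    have hmul := mul_le_mul_of_nonneg_left hp (h0 a)
    linarith

/-- With `s = β + n + i`, the quotient of `(i+1) w_{i+1}` by `w_i` is `s ∏ (1 - 1/(t j + s + 1))`,
bounded below by `one_sub_sum_le_prod_one_sub`. Since `s/(t j + s + 1) = 1 - (t j + 1)/(t j + s +
1)`, the constants add up to `s - (n+1) - i = β - 1`. -/
theorem gammaWeight_telescope (hβ : 0 < β) (ht : ∀ j, -1 < t j) {n : ℕ} (hn : n ≠ 0) (i : ℕ) :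
    gammaWeight t β n i
        * (β - 1 + ∑ j ∈ range (n + 1), (t j + 1) / (t j + (β + n + i) + 1))
      ≤ (i + 1) * gammaWeight t β n (i + 1) - i * gammaWeight t β n i := by
  have hn1 : (1 : ℝ) ≤ n := by exact_mod_cast Nat.one_le_iff_ne_zero.2 hn
  have hi := i.cast_nonneg (α := ℝ)
  set s : ℝ := β + n + i with hs
  have hX : ∀ j, 0 < t j + s := fun j => by linarith [ht j]
  have hspos : 0 < s := by linarith
  have hN : ∏ j ∈ range (n + 1), (t j + s) ≠ 0 := prod_ne_zero_iff.2 fun j _ => (hX j).ne'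
  have hN' : ∏ j ∈ range (n + 1), (t j + s + 1) ≠ 0 :=
    prod_ne_zero_iff.2 fun j _ => by linarith [hX j]
  have h1 : (i + 1) * gammaWeight t β n (i + 1) = gammaWeight t β n i
      * (s * ∏ j ∈ range (n + 1), (1 - 1 / (t j + s + 1))) := by
    have e1 : ∏ j ∈ range (n + 1), (1 - 1 / (t j + s + 1))
        = (∏ j ∈ range (n + 1), (t j + s)) / ∏ j ∈ range (n + 1), (t j + s + 1) := by
      rw [← prod_div_distrib]
      refine prod_congr rfl fun j _ => ?_
      have := hX j
      have : t j + s + 1 ≠ 0 := by linarith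
      field_simp
      ring
    have e2 : ∀ j, t j + (β + n + (i + 1 : ℕ)) = t j + s + 1 := fun j => by
      rw [hs]; push_cast; ring
    have h4 : (i.factorial : ℝ) ≠ 0 := by exact_mod_cast i.factorial_ne_zero
    have h5 : (i : ℝ) + 1 ≠ 0 := by positivity
    simp only [gammaWeight, e2, e1, ← hs]
    rw [← add_assoc, prod_range_succ (fun l : ℕ => β + (l : ℝ)), Nat.factorial_succ, Nat.cast_mul,
      show β + ((n + i : ℕ) : ℝ) = s by rw [hs]; push_cast; ring, Nat.cast_succ]
    field_simp
  have h2 := one_sub_sum_le_prod_one_sub (range (n + 1)) (f := fun j => 1 / (t j + s + 1))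
    (fun j => by have := hX j; positivity)
    (fun j => (div_le_one (by linarith [hX j])).2 (by linarith [hX j]))
  have h3 : s * (1 - ∑ j ∈ range (n + 1), 1 / (t j + s + 1)) - i
      = β - 1 + ∑ j ∈ range (n + 1), (t j + 1) / (t j + s + 1) := by
    have e3 : ∀ j, s * (1 / (t j + s + 1)) = 1 - (t j + 1) / (t j + s + 1) := fun j => by
      have : t j + s + 1 ≠ 0 := by linarith [hX j]
      field_simp
      ring
    rw [mul_sub, mul_sum, sum_congr rfl fun j _ => e3 j, sum_sub_distrib, sum_const, card_range,
      nsmul_eq_mul, hs]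
    push_cast
    ring
  rw [h1, mul_comm (i : ℝ), ← mul_sub]
  refine mul_le_mul_of_nonneg_left ?_ (gammaWeight_pos hβ ht hn i).le
  rw [← h3]
  have := mul_le_mul_of_nonneg_left h2 hspos.le
  linarith

end

/-! ### Ratio asymptotics of the divided differences -/

section

variable {t : ℕ → ℝ} {β : ℝ}

/-- Summing the telescoping bound up to `N` leaves the boundary term `N w_N`. Were the inequality
false, `N w_N` would stay above a positive constant, and the summable weights would dominate a
harmonic series. -/
theorem gammaWeight_sum_le (hβ : 0 < β) (ht : ∀ j, -1 < t j) {n : ℕ} (hn : n ≠ 0) {S S' a K : ℝ}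
    (hK : 1 ≤ K) (hKa : ∀ j ≤ n, t j + 1 + (β + n) ≤ K * a)
    (hS : HasSum (gammaWeight t β n) S)
    (hS' : HasSum (fun i : ℕ => gammaWeight t β n i / (i + a)) S') :
    (∑ j ∈ range (n + 1), (t j + 1)) / K * S' ≤ (1 - β) * S := by
  set T := ∑ j ∈ range (n + 1), (t j + 1)
  by_contra! hlt
  have hW := gammaWeight_pos hβ ht hn
  have hterm : ∀ i : ℕ, (β - 1) * gammaWeight t β n i + T / K * (gammaWeight t β n i / (i + a))
      ≤ ((i + 1 : ℕ) : ℝ) * gammaWeight t β n (i + 1) - i * gammaWeight t β n i := fun i => by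
    have hi := i.cast_nonneg (α := ℝ)
    push_cast
    refine le_trans ?_ (gammaWeight_telescope hβ ht hn i)
    have h1 : T / K / (i + a) ≤ ∑ j ∈ range (n + 1), (t j + 1) / (t j + (β + n + i) + 1) := by
      rw [div_div, sum_div]
      refine sum_le_sum fun j hj => ?_
      have hj1 := ht j
      have h2 := hKa j (Nat.lt_succ_iff.1 (mem_range.1 hj))
      have h3 : (i : ℝ) ≤ K * i := le_mul_of_one_le_left hi hK
      have hnn := n.cast_nonneg (α := ℝ)
      exact div_le_div_of_nonneg_left (by linarith) (by linarith) (by linarith)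
    have := mul_le_mul_of_nonneg_left h1 (hW i).le
    have e : T / K * (gammaWeight t β n i / (i + a)) = gammaWeight t β n i * (T / K / (i + a)) := by
      ring
    rw [e]
    linarith
  have hsum : ∀ N : ℕ, ∑ i ∈ range N,
      ((β - 1) * gammaWeight t β n i + T / K * (gammaWeight t β n i / (i + a)))
      ≤ N * gammaWeight t β n N := fun N => by
    refine (sum_le_sum fun i _ => hterm i).trans ?_
    rw [sum_range_sub (fun i : ℕ => (i : ℝ) * gammaWeight t β n i)]
    simp
  have hlim := ((hS.mul_left (β - 1)).add (hS'.mul_left (T / K))).tendsto_sum_nat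
  set δ := (β - 1) * S + T / K * S' with hδ
  have hδ0 : 0 < δ := by linarith
  have hev := hlim.eventually_const_lt (half_lt_self hδ0)
  refine Real.not_summable_natCast_inv ?_
  refine ((hS.summable.mul_left (2 / δ)).of_norm_bounded_eventually_nat ?_)
  filter_upwards [hev, eventually_gt_atTop 0] with N hN hN0
  have hN0' : (0 : ℝ) < N := by exact_mod_cast hN0
  have h1 := hN.trans_le (hsum N)
  rw [Real.norm_of_nonneg (by positivity), inv_le_iff_one_le_mul₀ hN0', div_mul_eq_mul_div,
    div_mul_eq_mul_div, one_le_div hδ0]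
  linarith

/-- With `a = t (n+1) + β + n`, passing from `n` to `n + 1` multiplies the `i`-th weight by
`i/(i+a)`. The decrease is thus `a` times the series of `w_i/(i+a)`, which `gammaWeight_sum_le`
controls. -/
theorem gammaDiff_succ_bounds (hβ : 0 < β) (hβ1 : β < 1) (ht : ∀ j, -1 < t j)
    (hinj : Function.Injective t) {n : ℕ} (hn : n ≠ 0) :
    0 < gammaDiff t β n ∧ gammaDiff t β (n + 1) ≤ gammaDiff t β n ∧
    ∀ K, 1 ≤ K → (∀ j ≤ n, t j + 1 + (β + n) ≤ K * (t (n + 1) + (β + n))) →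
      (∑ j ∈ range (n + 1), (t j + 1)) * (gammaDiff t β n - gammaDiff t β (n + 1))
        ≤ K * (t (n + 1) + (β + n)) * gammaDiff t β n := by
  have hn1 : (1 : ℝ) ≤ n := by exact_mod_cast Nat.one_le_iff_ne_zero.2 hn
  have hG : 0 < Real.Gamma (1 - β) := Real.Gamma_pos_of_pos (by linarith)
  have hW := gammaWeight_pos hβ ht hn
  have hS := hasSum_gammaWeight hβ hβ1 ht hinj hn
  have hS1 := hasSum_gammaWeight hβ hβ1 ht hinj n.succ_ne_zero
  set a := t (n + 1) + (β + n) with ha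
  have ha0 : 0 < a := by linarith [ht (n + 1)]
  have hS2 : HasSum (fun i : ℕ => gammaWeight t β n i * (i / (i + a)))
      (Real.Gamma (1 - β) * gammaDiff t β (n + 1)) := by
    rw [← hasSum_nat_add_iff' 1]
    refine hasSum_congr_eq hS1 (fun i => ?_) (by simp)
    have h1 := succ_mul_gammaWeight_succ hβ ht n i
    have h2 : (i : ℝ) + 1 + a ≠ 0 := by positivity
    push_cast at h1 ⊢
    rw [← mul_div_assoc, div_eq_iff h2, mul_comm _ ((i : ℝ) + 1), h1, ha]
    ring
  have hS3 : HasSum (fun i : ℕ => gammaWeight t β n i / (i + a))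
      (Real.Gamma (1 - β) * (gammaDiff t β n - gammaDiff t β (n + 1)) / a) := by
    refine hasSum_congr_eq ((hS.sub hS2).div_const a) (fun i => ?_) (by ring)
    have h2 : (i : ℝ) + a ≠ 0 := by positivity
    field_simp
    ring
  have hF : 0 < gammaDiff t β n := by
    have h := hS.summable.tsum_pos (fun i => (hW i).le) 0 (hW 0)
    rw [hS.tsum_eq] at h
    exact pos_of_mul_pos_right h hG.le
  refine ⟨hF, ?_, fun K hK hKa => ?_⟩
  · have h := hS3.nonneg fun i => by
      have := hW i
      positivity
    rw [mul_div_assoc] at h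
    have h := nonneg_of_mul_nonneg_right h hG
    have h := mul_nonneg h ha0.le
    rw [div_mul_cancel₀ _ ha0.ne'] at h
    linarith
  · have h := gammaWeight_sum_le hβ ht hn hK hKa hS hS3
    have hK0 : 0 < K := by linarith
    have h1 : (∑ j ∈ range (n + 1), (t j + 1)) * (gammaDiff t β n - gammaDiff t β (n + 1))
        ≤ K * a * ((1 - β) * gammaDiff t β n) := by
      rw [div_mul_div_comm, div_le_iff₀ (by positivity)] at h
      refine le_of_mul_le_mul_left ?_ hG
      linarith
    refine h1.trans (mul_le_mul_of_nonneg_left ?_ (by positivity))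
    nlinarith

theorem tendsto_gammaDiff_succ_div_of_lt_one (hβ : 0 < β) (hβ1 : β < 1) (ht : ∀ j, -1 < t j)
    (hinj : Function.Injective t) {C : ℝ} (hC : ∀ j : ℕ, |t j - j / 2| ≤ C) :
    Tendsto (fun n => gammaDiff t β (n + 1) / gammaDiff t β n) atTop (𝓝 1) := by
  -- `48 = 8 · 3 · 2`: the node sum is at least `n²/8`, the bound is applied with `K = 3`, and `t
  -- (n+1) + β + n ≤ 2n`.
  have hlow : Tendsto (fun n : ℕ => 1 - 48 / (n : ℝ)) atTop (𝓝 1) := by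
    simpa using (tendsto_const_div_atTop_nhds_zero_nat (48 : ℝ)).const_sub 1
  refine tendsto_of_tendsto_of_tendsto_of_le_of_le' hlow tendsto_const_nhds ?_ ?_
  · filter_upwards [eventually_gt_atTop 3, eventually_ge_atTop ⌈8 * C + 8⌉₊] with n hn3 hnC
    have hn0 : n ≠ 0 := by omega
    have hn3' : (3 : ℝ) ≤ n := by exact_mod_cast hn3.le
    have hnC' : 8 * C + 8 ≤ n := Nat.ceil_le.1 hnC
    have hC0 : 0 ≤ C := (abs_nonneg _).trans (hC 0)
    obtain ⟨hF, hmono, hb⟩ := gammaDiff_succ_bounds hβ hβ1 ht hinj hn0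
    have hup : ∀ j : ℕ, t j ≤ j / 2 + C := fun j => by linarith [(abs_le.1 (hC j)).2]
    have hlo : ∀ j : ℕ, (j : ℝ) / 2 - C ≤ t j := fun j => by linarith [(abs_le.1 (hC j)).1]
    have h1 := hb 3 (by norm_num) fun j hj => by
      have hj' : (j : ℝ) ≤ n := by exact_mod_cast hj
      have := hup j
      have := ht (n + 1)
      linarith
    have ha : t (n + 1) + (β + n) ≤ 2 * n := by
      have := hup (n + 1)
      push_cast at this
      linarith
    have hT : (n : ℝ) * n / 8 ≤ ∑ j ∈ range (n + 1), (t j + 1) := by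
      have h2 : ∑ j ∈ range (n + 1), ((j : ℝ) / 2 - C) ≤ ∑ j ∈ range (n + 1), (t j + 1) :=
        sum_le_sum fun j _ => by linarith [hlo j]
      have h3 : ∑ j ∈ range (n + 1), (j : ℝ) = n * (n + 1) / 2 := by
        have h4 := congrArg (Nat.cast : ℕ → ℝ) (Finset.sum_range_id_mul_two (n + 1))
        rw [Nat.add_sub_cancel] at h4
        push_cast at h4
        linarith
      rw [sum_sub_distrib, ← sum_div, h3, sum_const, card_range, nsmul_eq_mul] at h2
      push_cast at h2
      nlinarith
    have h5 : (n : ℝ) * n / 8 * (gammaDiff t β n - gammaDiff t β (n + 1))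
        ≤ 3 * (2 * n) * gammaDiff t β n := by
      refine (mul_le_mul_of_nonneg_right hT (by linarith)).trans (h1.trans ?_)
      gcongr
    have hnpos : (0 : ℝ) < n := by linarith
    rw [le_div_iff₀ hF, sub_mul, div_mul_eq_mul_div, one_mul, sub_le_comm, le_div_iff₀ hnpos]
    have h6 : (n : ℝ) * ((gammaDiff t β n - gammaDiff t β (n + 1)) * n)
        ≤ n * (48 * gammaDiff t β n) := by linarith
    exact le_of_mul_le_mul_left h6 hnpos
  · filter_upwards [eventually_ne_atTop 0] with n hn
    obtain ⟨hF, hmono, -⟩ := gammaDiff_succ_bounds hβ hβ1 ht hinj hn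
    exact (div_le_one hF).2 hmono

/-- If the increments of a positive sequence have ratios tending to `1`, so does the sequence. -/
theorem tendsto_succ_div_of_increments {A G : ℕ → ℝ} (hA : ∀ n, 0 < A n)
    (hG : ∀ n, 0 < G (n + 1)) (h : ∀ n, A (n + 1) = A n + G (n + 1))
    (hlim : Tendsto (fun n => G (n + 1) / G n) atTop (𝓝 1)) :
    Tendsto (fun n => A (n + 1) / A n) atTop (𝓝 1) := by
  -- Bootstrapping shows `A n / G (n+1) → ∞`: one step adds `1` to this quotient and multiplies it
  -- by a factor tending to `1`, so an asymptotic lower bound `K` improves to `K + 1`.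
  have key : ∀ K : ℕ, ∀ c < (K : ℝ), ∀ᶠ n in atTop, c < A n / G (n + 1) := by
    intro K
    induction K with
    | zero =>
      intro c hc
      exact Eventually.of_forall fun n => (hc.trans_eq Nat.cast_zero).trans (div_pos (hA n) (hG n))
    | succ K ih =>
      intro c hc
      push_cast at hc
      obtain ⟨d, hd1, hd2⟩ := exists_between (sub_lt_iff_lt_add.2 hc)
      obtain ⟨e, he1, he2⟩ := exists_between (max_lt hd2 (by linarith : d < K))
      have hde : d < e := (le_max_right _ _).trans_lt he1
      have h1 := ((hlim.inv₀ one_ne_zero).const_mul (e + 1)).eventually_const_lt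
        (show c < (e + 1) * 1⁻¹ by rw [inv_one, mul_one]; linarith)
      rw [← map_add_atTop_eq_nat 1, eventually_map]
      filter_upwards [ih e he2, (tendsto_add_atTop_nat 1).eventually h1] with n hn1 hn2
      refine hn2.trans ?_
      have g1 := hG n
      have g2 := hG (n + 1)
      rw [inv_div, h n]
      rw [lt_div_iff₀ g1] at hn1
      rw [← mul_div_assoc]
      gcongr
      linarith
  have hinf : Tendsto (fun n => A n / G (n + 1)) atTop atTop :=
    tendsto_atTop.2 fun M => by
      obtain ⟨K, hK⟩ := exists_nat_gt M
      exact (key K M hK).mono fun n hn => hn.le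
  have h2 := hinf.inv_tendsto_atTop.const_add 1
  rw [add_zero] at h2
  refine h2.congr fun n => ?_
  have := (hA n).ne'
  simp only [Pi.inv_apply, inv_div]
  rw [h n]
  field_simp

theorem gammaDiff_asymptotics (hβ : 0 < β) (ht : ∀ j, -1 < t j)
    (hinj : Function.Injective t) {C : ℝ} (hC : ∀ j : ℕ, |t j - j / 2| ≤ C)
    (hlim : Tendsto (fun n : ℕ => t n / n) atTop (𝓝 (1 / 2))) :
    (∀ n ≠ 0, 0 < gammaDiff t β n) ∧
      Tendsto (fun n => gammaDiff t β (n + 1) / gammaDiff t β n) atTop (𝓝 1) := by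
  -- Induction over the intervals `(k, k + 1]`: by `gammaDiff_add_one_succ`, the sequence for `β`
  -- has increments given by the one for `β - 1`.
  have key : ∀ k : ℕ, ∀ β : ℝ, k < β → β ≤ k + 1 → (∀ n ≠ 0, 0 < gammaDiff t β n) ∧
      Tendsto (fun n => gammaDiff t β (n + 1) / gammaDiff t β n) atTop (𝓝 1) := by
    intro k
    induction k with
    | zero =>
      intro β h1 h2
      norm_num at h1 h2
      rcases h2.eq_or_lt with rfl | h2
      · simp [gammaDiff_one ht hinj]
      · exact ⟨fun n hn => (gammaDiff_succ_bounds h1 h2 ht hinj hn).1,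
          tendsto_gammaDiff_succ_div_of_lt_one h1 h2 ht hinj hC⟩
    | succ k ih =>
      intro β h1 h2
      push_cast at h1 h2
      obtain ⟨hpos, hrat⟩ := ih (β - 1) (by linarith) (by linarith)
      have hβ' : 0 < β - 1 := by linarith [k.cast_nonneg (α := ℝ)]
      have hrec := gammaDiff_add_one_succ hβ' ht hinj
      rw [sub_add_cancel] at hrec
      have hc : ∀ n : ℕ, 0 < t (n + 1) + (β - 1 + (n + 1 : ℕ)) := fun n => by
        push_cast
        linarith [ht (n + 1), n.cast_nonneg (α := ℝ)]
      have hG : ∀ n : ℕ, 0 < (t (n + 1) + (β - 1 + (n + 1 : ℕ))) * gammaDiff t (β - 1) (n + 1) :=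
        fun n => mul_pos (hc n) (hpos _ n.succ_ne_zero)
      have hA : ∀ n, 0 < gammaDiff t β n := by
        intro n
        induction n with
        | zero =>
          have h0 := ht 0
          rw [gammaDiff, dividedDiff, zero_add, sum_range_one, range_one, erase_singleton,
            prod_empty, div_one, Nat.cast_zero, add_zero]
          exact div_pos (Real.Gamma_pos_of_pos (by linarith)) (Real.Gamma_pos_of_pos (by linarith))
        | succ n ih => rw [hrec]; linarith [hG n]
      refine ⟨fun n _ => hA n, tendsto_succ_div_of_increments
        (G := fun n => (t n + (β - 1 + n)) * gammaDiff t (β - 1) n) hA hG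
        (fun n => by rw [hrec, add_comm]) ?_⟩
      have h3 := ((tendsto_const_add_node_div hlim β 1).div
        (tendsto_const_add_node_div hlim (β - 1) 0) (by norm_num)).mul hrat
      norm_num at h3
      refine h3.congr' ?_
      filter_upwards [eventually_ne_atTop 0] with n hn
      have : (n : ℝ) ≠ 0 := by exact_mod_cast hn
      rw [div_div_div_cancel_right₀ this, div_mul_div_comm]
      push_cast
      ring_nf
  obtain ⟨k, hk⟩ : ∃ k : ℕ, (k : ℝ) < β ∧ β ≤ k + 1 := by
    have h1 := Nat.ceil_lt_add_one hβ.le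
    have h2 : 0 < ⌈β⌉₊ := Nat.ceil_pos.2 hβ
    refine ⟨⌈β⌉₊ - 1, ?_, ?_⟩
    · rw [Nat.cast_pred h2]
      linarith
    · rw [Nat.cast_pred h2]
      linarith [Nat.le_ceil β]
  exact key k β hk.1 hk.2

end

/-! ### Growth of `Q_n(1)` and the limits of the stochastic matrices -/

section

variable {α₀ α₁ α₂ : ℝ}

theorem Q_one_pos (h₀ : -1 < α₀) (h₁ : -1 < α₁) (h₂ : -1 < α₂)
    (h₁₂ : ∀ m : ℤ, α₁ - α₂ ≠ m) (n : ℕ) : 0 < Q α₀ α₁ α₂ n 1 := by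
  rcases Nat.eq_zero_or_pos n with rfl | hn
  · exact Q_zero_one_pos h₀ h₁ h₂ h₁₂
  · have hβ : 0 < α₀ + 1 := by linarith
    have ht := neg_one_lt_node h₁ h₂
    have hn1 : (1 : ℝ) ≤ n := by exact_mod_cast hn
    rw [Q_one h₀ h₁ h₂ h₁₂ hn.ne']
    exact mul_pos ((gammaDiff_asymptotics hβ ht (node_injective h₁₂) (abs_node_sub_le α₁ α₂)
      (tendsto_node_div α₁ α₂)).1 n hn.ne') (div_pos (by linarith [ht n])
      (mul_pos (typeIIAtOne_pos hβ ht n) (Real.Gamma_pos_of_pos hβ)))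

theorem tendsto_Q_one_succ_div (h₀ : -1 < α₀) (h₁ : -1 < α₁) (h₂ : -1 < α₂)
    (h₁₂ : ∀ m : ℤ, α₁ - α₂ ≠ m) :
    Tendsto (fun n => Q α₀ α₁ α₂ (n + 1) 1 / Q α₀ α₁ α₂ n 1) atTop (𝓝 (27 / 8)) := by
  have hβ : 0 < α₀ + 1 := by linarith
  have ht := neg_one_lt_node h₁ h₂
  have hlim := tendsto_node_div α₁ α₂
  obtain ⟨hpos, hF⟩ := gammaDiff_asymptotics hβ ht (node_injective h₁₂) (abs_node_sub_le α₁ α₂) hlim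
  have hb := (tendsto_typeIIAtOne_succ_div hβ ht (node_add_two α₁ α₂) hlim).inv₀ (by norm_num)
  have hr := (tendsto_const_add_node_div hlim (α₀ + 2) 1).div
    (tendsto_const_add_node_div hlim (α₀ + 1) 0) (by norm_num)
  have h := (hF.mul hr).mul hb
  norm_num at h
  refine h.congr' ?_
  filter_upwards [eventually_ne_atTop 0] with n hn
  have hn1 : (1 : ℝ) ≤ n := by exact_mod_cast Nat.one_le_iff_ne_zero.2 hn
  rw [Q_one h₀ h₁ h₂ h₁₂ hn, Q_one h₀ h₁ h₂ h₁₂ n.succ_ne_zero]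
  change _ = gammaDiff _ _ (n + 1) * _ / (gammaDiff _ _ n * _)
  have n1 := (hpos n hn).ne'
  have n2 := (typeIIAtOne_pos hβ ht n).ne'
  have n3 := (typeIIAtOne_pos hβ ht (n + 1)).ne'
  have n4 := (Real.Gamma_pos_of_pos hβ).ne'
  have n5 : α₀ + 1 + n + node α₁ α₂ n ≠ 0 := by linarith [ht n]
  have n6 : (n : ℝ) ≠ 0 := by linarith
  have e : α₀ + 1 + ((n + 1 : ℕ) : ℝ) + node α₁ α₂ (n + 1) = α₀ + 2 + n + node α₁ α₂ (n + 1) := by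
    push_cast; ring
  rw [e]
  field_simp

/-- The two entries are `h` times `q (n+k) / q n` and `h` times `p n / p (n+k)`; inverse growth
rates give these quotients the same limit. -/
theorem tendsto_stochastic_limits {h : Matrix ℕ ℕ ℝ} {p q : ℕ → ℝ} {r : ℝ} (hr : r ≠ 0)
    (hp0 : ∀ n, p n ≠ 0) (hq0 : ∀ n, q n ≠ 0)
    (hp : Tendsto (fun n => p (n + 1) / p n) atTop (𝓝 r))
    (hq : Tendsto (fun n => q (n + 1) / q n) atTop (𝓝 r⁻¹))
    (h1 : ∀ n, h n (n + 1) = 1) (h2 : ∀ n, h n (n + 2) = 0)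
    (hlim : ∀ k ≤ 2, ∃ a, Tendsto (fun n => h (n + k) n) atTop (𝓝 a)) (k : ℤ) (hk : -2 ≤ k)
    (hk' : k ≤ 2) : ∃ L : ℝ,
      Tendsto (fun n : ℕ => (q n)⁻¹ * h ((n : ℤ) + k).toNat n * q ((n : ℤ) + k).toNat) atTop (𝓝 L) ∧
      Tendsto (fun n : ℕ => (p ((n : ℤ) + k).toNat)⁻¹ * h ((n : ℤ) + k).toNat n * p n)
        atTop (𝓝 L) := by
  have hr' := inv_ne_zero hr
  have key : ∀ k : ℕ, ∀ a u : ℝ, Tendsto (fun n => h (n + k) n) atTop (𝓝 a) →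
      Tendsto (fun n => q (n + k) / q n) atTop (𝓝 u⁻¹) →
      Tendsto (fun n => p (n + k) / p n) atTop (𝓝 u) → u ≠ 0 → ∃ L : ℝ,
      Tendsto (fun n : ℕ => (q n)⁻¹ * h (n + k) n * q (n + k)) atTop (𝓝 L) ∧
      Tendsto (fun n : ℕ => (p (n + k))⁻¹ * h (n + k) n * p n) atTop (𝓝 L) := by
    intro k a u ha hqk hpk hu
    refine ⟨a * u⁻¹, (ha.mul hqk).congr fun n => by ring, (ha.mul (hpk.inv₀ hu)).congr fun n => ?_⟩
    rw [inv_div]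
    ring
  have hnat : ∀ k : ℕ, ∀ n : ℕ, ((n : ℤ) + k).toNat = n + k := fun k n => by omega
  interval_cases k
  -- For negative `k` the index is shifted so that `toNat` does not truncate.
  · refine ⟨0, ?_, ?_⟩ <;> rw [← tendsto_add_atTop_iff_nat 2]
    all_goals
      refine tendsto_const_nhds.congr fun n => ?_
      rw [show (((n + 2 : ℕ) : ℤ) + -2).toNat = n by omega, h2]
      ring
  · refine ⟨r, ?_, ?_⟩ <;> rw [← tendsto_add_atTop_iff_nat 1]
    · have := hq.inv₀ hr'
      rw [inv_inv] at this
      refine this.congr fun n => ?_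
      rw [show (((n + 1 : ℕ) : ℤ) + -1).toNat = n by omega, h1, inv_div]
      ring
    · refine hp.congr fun n => ?_
      rw [show (((n + 1 : ℕ) : ℤ) + -1).toNat = n by omega, h1]
      ring
  · obtain ⟨a, ha⟩ := hlim 0 (by norm_num)
    have h3 := key 0 a 1 ha
      (by simp only [add_zero, div_self (hq0 _), inv_one]; exact tendsto_const_nhds)
      (by simp only [add_zero, div_self (hp0 _)]; exact tendsto_const_nhds) one_ne_zero
    simpa using h3
  · obtain ⟨a, ha⟩ := hlim 1 (by norm_num)
    have h3 := key 1 a r ha hq hp hr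
    simpa only [← hnat, Nat.cast_one] using h3
  · obtain ⟨a, ha⟩ := hlim 2 (by norm_num)
    have h3 := key 2 a (r * r) ha (by rw [mul_inv]; exact tendsto_add_two_div hq0 hq)
      (tendsto_add_two_div hp0 hp) (mul_ne_zero hr hr)
    simpa only [← hnat, Nat.cast_ofNat] using h3

end

end JacobiPineiro

theorem mainTheorem1 (α₀ α₁ α₂ : ℝ) (h₀ : -1 < α₀) (h₁ : -1 < α₁) (h₂ : -1 < α₂)
    (h₁₂ : ∀ m : ℤ, α₁ - α₂ ≠ m) :
    -- the moment matrix has exactly one Gauss–Borel factorization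
    (∃! F : JacobiPineiro.Factors,
      JacobiPineiro.IsGaussBorel (JacobiPineiro.moment α₀ α₁ α₂) F) ∧
    -- the two diagonal matrices that are used for the conjugations are invertible
    (∀ n : ℕ, JacobiPineiro.B α₀ α₁ α₂ n 1 ≠ 0 ∧ JacobiPineiro.Q α₀ α₁ α₂ n 1 ≠ 0) ∧
    -- the two limits exist and coincide
    ∀ k : ℤ, -2 ≤ k → k ≤ 2 → ∃ L : ℝ,
      Tendsto (fun n : ℕ => JacobiPineiro.checkH α₀ α₁ α₂ n ((n : ℤ) + k).toNat) atTop (𝓝 L) ∧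
      Tendsto (fun n : ℕ => JacobiPineiro.hatH α₀ α₁ α₂ ((n : ℤ) + k).toNat n) atTop (𝓝 L) := by
  have hF := JacobiPineiro.isGaussBorel_factors h₀ h₁ h₂ h₁₂
  have hB : ∀ n, JacobiPineiro.B α₀ α₁ α₂ n 1 ≠ 0 := fun n => by
    rw [JacobiPineiro.B_one h₀ h₁ h₂ h₁₂]
    exact (JacobiPineiro.typeIIAtOne_pos (by linarith)
      (JacobiPineiro.neg_one_lt_node h₁ h₂) n).ne'
  have hQ : ∀ n, JacobiPineiro.Q α₀ α₁ α₂ n 1 ≠ 0 := fun n =>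
    (JacobiPineiro.Q_one_pos h₀ h₁ h₂ h₁₂ n).ne'
  refine ⟨⟨_, hF, fun F hF' => hF'.unique hF⟩, fun n => ⟨hB n, hQ n⟩, ?_⟩
  exact JacobiPineiro.tendsto_stochastic_limits (h := JacobiPineiro.hess α₀ α₁ α₂)
    (p := fun n => JacobiPineiro.B α₀ α₁ α₂ n 1) (q := fun n => JacobiPineiro.Q α₀ α₁ α₂ n 1)
    (r := 8 / 27) (by norm_num) hB hQ (JacobiPineiro.tendsto_B_one_succ_div h₀ h₁ h₂ h₁₂)
    (by rw [inv_div]; exact JacobiPineiro.tendsto_Q_one_succ_div h₀ h₁ h₂ h₁₂)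
    (JacobiPineiro.hessOf_succ hF.1) (fun n => JacobiPineiro.hessOf_eq_zero (by omega))
    (JacobiPineiro.exists_tendsto_hess h₀ h₁ h₂ h₁₂)
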